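/- Let $w[k]\in\mathbb{R}^n$, $k\in\mathbb{Z}$, be a zero-mean stationary stochastic process with finite second moments, autocovariance $R[k]=\mathbb{E}[w[i+k]w[i]^\top]$ and power spectral density $\Phi(z)=\sum_{k\in\mathbb{Z}} z^{-k}R[k]$ (the series converging for $|z|=1$). Assume that there are constants $c_{\min},c_{\max}>0$ with $c_{\min}I\preceq\Phi(e^{j\omega})\preceq c_{\max}I$ for all $\omega\in[0,2\pi]$, and that $\Phi$ is rational. Let $H(z)=\sum_{k\ge1}H_kz^{-k}$ be the optimal (linear, strictly causal) predictor for $w$, that is, $\hat w[k]=\sum_{i\ge1}H_iw[k-i]$ (in mean square) has the minimum mean-squared error among all linear predictions of $w[k]$ from $w[k-1],w[k-2],\ldots$, and let $\Sigma=\mathbb{E}[(w[k]-\hat w[k])(w[k]-\hat w[k])^\top]$ be the prediction error covariance (which does not depend on $k$). For $i\ge1$ let $w[0:i]=[w[0]^\top\ \cdots\ w[i-1]^\top]^\top$, $A_i=\mathbb{E}[w[0:i]\,w[0:i]^\top]$ and $B_i=\mathbb{E}[w[i]\,w[0:i]^\top]$. Let $\rho\in(0,1)$ be such that every pole $s$ of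 $H$ satisfies $|s|<\rho$, and let $b\ge\sup_{|z|\ge\rho}\|H(z)\|_2$. Then for all $i\ge1$ the matrix $A_i$ is invertible and $$\left\|\Sigma-\left(R[0]-B_iA_i^{-1}B_i^\top\right)\right\|_2\le\frac{b^2\rho^{2(i+1)}}{(1-\rho)^2}\,c_{\max},$$ where $\|\cdot\|_2$ is the spectral norm. -/

import Mathlib

open MeasureTheory Filter Topology
open scoped Matrix Matrix.Norms.L2Operator ComplexOrder

noncomputable section

namespace LinPred

/-- The matrix `E[u vᵀ]` for random vectors `u` and `v`. -/
def crossCov {Ω ι κ : Type*} [MeasurableSpace Ω] (P : Measure Ω)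
    (u : Ω → ι → ℝ) (v : Ω → κ → ℝ) : Matrix ι κ ℝ :=
  Matrix.of fun a b => ∫ ω, u ω a * v ω b ∂P

/-- The mean-squared error `E[‖u - v‖₂²]`. -/
def mse {Ω ι : Type*} [MeasurableSpace Ω] [Fintype ι] (P : Measure Ω)
    (u v : Ω → ι → ℝ) : ℝ :=
  ∫ ω, ∑ a, (u ω a - v ω a) ^ 2 ∂P

/-- A zero-mean, square-integrable `ℝⁿ`-valued process on `ℤ` that is stationary (to second order:
`E[w[i+k] w[i]ᵀ]` does not depend on `i`). Strictly stationary processes with finite second moments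
are a special case. -/
structure IsStationary {Ω : Type*} [MeasurableSpace Ω] {n : ℕ} (P : Measure Ω)
    (w : ℤ → Ω → Fin n → ℝ) : Prop where
  memLp : ∀ k a, MemLp (fun ω => w k ω a) 2 P
  mean_zero : ∀ k a, ∫ ω, w k ω a ∂P = 0
  cov_shift : ∀ i k : ℤ, crossCov P (w (i + k)) (w i) = crossCov P (w k) (w 0)

/-- The autocovariance `R[k] = E[w[k] w[0]ᵀ]`. -/
def autocov {Ω : Type*} [MeasurableSpace Ω] {n : ℕ} (P : Measure Ω)
    (w : ℤ → Ω → Fin n → ℝ) (k : ℤ) : Matrix (Fin n) (Fin n) ℝ :=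
  crossCov P (w k) (w 0)

/-- The `k`-th term `z⁻ᵏ R[k]` of the power spectral density series. -/
def psdTerm {Ω : Type*} [MeasurableSpace Ω] {n : ℕ} (P : Measure Ω)
    (w : ℤ → Ω → Fin n → ℝ) (z : ℂ) (k : ℤ) : Matrix (Fin n) (Fin n) ℂ :=
  z ^ (-k) • (autocov P w k).map Complex.ofReal

/-- The power spectral density `Φ(z) = ∑ₖ z⁻ᵏ R[k]`. -/
def psd {Ω : Type*} [MeasurableSpace Ω] {n : ℕ} (P : Measure Ω)
    (w : ℤ → Ω → Fin n → ℝ) (z : ℂ) : Matrix (Fin n) (Fin n) ℂ :=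
  ∑' k : ℤ, psdTerm P w z k

/-- The series defining `Φ` converges on the unit circle. -/
def HasPsd {Ω : Type*} [MeasurableSpace Ω] {n : ℕ} (P : Measure Ω)
    (w : ℤ → Ω → Fin n → ℝ) : Prop :=
  ∀ z : ℂ, ‖z‖ = 1 → Summable (psdTerm P w z)

/-- `c_min I ≼ Φ(z) ≼ c_max I` for all `z` on the unit circle. -/
def PsdBounds {Ω : Type*} [MeasurableSpace Ω] {n : ℕ} (P : Measure Ω)
    (w : ℤ → Ω → Fin n → ℝ) (cmin cmax : ℝ) : Prop :=
  ∀ z : ℂ, ‖z‖ = 1 →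
    (psd P w z - (cmin : ℂ) • (1 : Matrix (Fin n) (Fin n) ℂ)).PosSemidef ∧
    ((cmax : ℂ) • (1 : Matrix (Fin n) (Fin n) ℂ) - psd P w z).PosSemidef

/-- `z` is a pole of the matrix `Q` of rational functions: the reduced denominator of some entry
vanishes at `z`. -/
def IsPole {n : ℕ} (Q : Matrix (Fin n) (Fin n) (RatFunc ℂ)) (z : ℂ) : Prop :=
  ∃ a b, (Q a b).denom.eval z = 0

/-- The value at `z` of a matrix of rational functions (meaningful where `z` is not a pole). -/
def evalMatrix {n : ℕ} (Q : Matrix (Fin n) (Fin n) (RatFunc ℂ)) (z : ℂ) :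
    Matrix (Fin n) (Fin n) ℂ :=
  Q.map (RatFunc.eval (RingHom.id ℂ) z)

/-- `Φ` is rational: on the unit circle it agrees with a matrix of rational functions. -/
def PsdRational {Ω : Type*} [MeasurableSpace Ω] {n : ℕ} (P : Measure Ω)
    (w : ℤ → Ω → Fin n → ℝ) : Prop :=
  ∃ Q : Matrix (Fin n) (Fin n) (RatFunc ℂ),
    ∀ z : ℂ, ‖z‖ = 1 → ¬ IsPole Q z ∧ evalMatrix Q z = psd P w z

/-- The finite-order linear one-step prediction `∑_{i=1}^N Gᵢ w[k-i]`. -/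
def finitePrediction {Ω : Type*} {n : ℕ} (w : ℤ → Ω → Fin n → ℝ)
    (G : ℕ → Matrix (Fin n) (Fin n) ℝ) (N : ℕ) (k : ℤ) (ω : Ω) : Fin n → ℝ :=
  ∑ i ∈ Finset.Icc 1 N, G i *ᵥ w (k - i) ω

/-- `H` (the coefficients `Hᵢ`, `i ≥ 1`; the value at `0` is not used) is the optimal predictor for
`w`, with predictions `what`: `what[k] = ∑_{i≥1} Hᵢ w[k-i]` in mean square, and `what[k]` has the
minimum mean-squared error among all linear predictions of `w[k]` from its past. It suffices to
compare with finite-order predictions, since they are dense in mean square among all linear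
predictions. -/
structure IsOptimalPredictor {Ω : Type*} [MeasurableSpace Ω] {n : ℕ} (P : Measure Ω)
    (w : ℤ → Ω → Fin n → ℝ) (H : ℕ → Matrix (Fin n) (Fin n) ℝ)
    (what : ℤ → Ω → Fin n → ℝ) : Prop where
  memLp : ∀ k a, MemLp (fun ω => what k ω a) 2 P
  series : ∀ k, Tendsto (fun N => mse P (what k) (finitePrediction w H N k)) atTop (𝓝 0)
  optimal : ∀ k (G : ℕ → Matrix (Fin n) (Fin n) ℝ) (N : ℕ),
    mse P (w k) (what k) ≤ mse P (w k) (finitePrediction w G N k)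

/-- The prediction error covariance `E[(w[k] - what[k]) (w[k] - what[k])ᵀ]`. -/
def errorCov {Ω : Type*} [MeasurableSpace Ω] {n : ℕ} (P : Measure Ω)
    (w what : ℤ → Ω → Fin n → ℝ) (k : ℤ) : Matrix (Fin n) (Fin n) ℝ :=
  crossCov P (fun ω => w k ω - what k ω) (fun ω => w k ω - what k ω)

/-- The term `H_{i+1} z^{-(i+1)}` of the transfer matrix. -/
def transferTerm {n : ℕ} (H : ℕ → Matrix (Fin n) (Fin n) ℝ) (z : ℂ) (i : ℕ) :
    Matrix (Fin n) (Fin n) ℂ :=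
  (z ^ (i + 1))⁻¹ • (H (i + 1)).map Complex.ofReal

/-- The transfer matrix `H(z) = ∑_{i≥1} Hᵢ z⁻ⁱ`. -/
def transferMatrix {n : ℕ} (H : ℕ → Matrix (Fin n) (Fin n) ℝ) (z : ℂ) :
    Matrix (Fin n) (Fin n) ℂ :=
  ∑' i : ℕ, transferTerm H z i

/-- The matrix `Q` of rational functions is the transfer matrix of `H`: its expansion at infinity
is `∑_{i≥1} Hᵢ z⁻ⁱ`. Such a `Q` is unique. -/
def IsTransferMatrix {n : ℕ} (H : ℕ → Matrix (Fin n) (Fin n) ℝ)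
    (Q : Matrix (Fin n) (Fin n) (RatFunc ℂ)) : Prop :=
  ∀ᶠ z in Bornology.cobounded ℂ, HasSum (transferTerm H z) (evalMatrix Q z)

/-- The set of poles of the transfer matrix of `H`, for `H` with a rational transfer matrix. (The
optimal predictor of a process with rational spectral density bounded above and below always has
one.) -/
def transferPoles {n : ℕ} (H : ℕ → Matrix (Fin n) (Fin n) ℝ) : Set ℂ :=
  {s | ∃ Q, IsTransferMatrix H Q ∧ IsPole Q s}

/-- The stacked vector `w[0:i]`, with entries indexed by time and coordinate. -/
def stack {Ω : Type*} {n : ℕ} (w : ℤ → Ω → Fin n → ℝ) (i : ℕ) (ω : Ω) : Fin i × Fin n → ℝ :=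
  fun p => w (p.1 : ℕ) ω p.2

/-- `Aᵢ = E[w[0:i] w[0:i]ᵀ]`. -/
def pastCov {Ω : Type*} [MeasurableSpace Ω] {n : ℕ} (P : Measure Ω)
    (w : ℤ → Ω → Fin n → ℝ) (i : ℕ) : Matrix (Fin i × Fin n) (Fin i × Fin n) ℝ :=
  crossCov P (stack w i) (stack w i)

/-- `Bᵢ = E[w[i] w[0:i]ᵀ]`. -/
def presentPastCov {Ω : Type*} [MeasurableSpace Ω] {n : ℕ} (P : Measure Ω)
    (w : ℤ → Ω → Fin n → ℝ) (i : ℕ) : Matrix (Fin n) (Fin i × Fin n) ℝ :=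
  crossCov P (w i) (stack w i)

end LinPred

end

/-!
The argument works with the vectors `W k a ∈ L²(P)` given by the coordinates of `w[k]`. Let `d` be
the difference between the optimal prediction `what[i]` and the best prediction of `w[i]` from
`w[0], …, w[i-1]` alone. The optimal prediction error is orthogonal to the whole past, so the error
of the finite prediction splits orthogonally, and the difference of the error covariances
`R[0] - B A⁻¹ Bᵀ` and `Σ` is the Gram matrix of `d`. As `d` is the component of `what[i]`
orthogonal to the span of these `i` past values, it is no longer than
`what[i] - ∑_{j ≤ i} H_j w[i-j] = ∑_{j > i} H_j w[i-j]` (`IsBestPrediction.norm_sub_schur_le`). The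
upper bound on `Φ` turns this tail into `c_max ∑_{j > i} ‖H_jᵀ x‖²` (`norm_sq_sum_smul_le`), and the
Cauchy estimate `‖H_j‖ ≤ b ρ ^ j` (`norm_coeff_le_of_transferMatrix_le`) leaves a geometric series.
The lower bound on `Φ` makes `A` injective, hence invertible.

The Cauchy estimate needs `∑ H_j z⁻ʲ` to converge for `|z| > ρ`. The assumption on the poles gives
this once `H` is known to have a rational transfer matrix, which is proved here without spectral
factorization. Orthogonality of the prediction error to the past says that `(1 - H) Φ` has no
coefficient at `z⁻ᵐ` for `m ≥ 1`. Write `q Φ = M` on the unit circle with a polynomial `q` and a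
polynomial matrix `M`. Then `(1 - H) M = q (1 - H) Φ` has only nonnegative powers of `z`, and also
no powers above the degree of `M`; so it is a polynomial matrix `S` (`exists_polynomial_mul`), and
`H = 1 - S M⁻¹` is rational (`exists_isTransferMatrix`).
-/

namespace LinPred

/-! ### Laurent series on the unit circle -/

/-- The coefficients of a Laurent series that converges on the unit circle are the Fourier
coefficients of its sum. In finite dimension, convergence at `1` alone makes the coefficients
absolutely summable, so the series may be integrated term by term. -/
theorem laurentCoeff_eq_integral {V : Type*} [NormedAddCommGroup V] [NormedSpace ℂ V]
    [FiniteDimensional ℂ V] {c : ℤ → V} {F : ℂ → V}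
    (h : ∀ z : ℂ, ‖z‖ = 1 → HasSum (fun j => z ^ j • c j) (F z)) (k : ℤ) :
    c k = ∫ t : UnitAddCircle, fourier (-k) t • F (fourier 1 t) ∂AddCircle.haarAddCircle := by
  have : CompleteSpace V := FiniteDimensional.complete ℂ V
  have hc : Summable fun j => ‖c j‖ := by
    have h1 := (h 1 norm_one).summable
    simp only [one_zpow, one_smul] at h1
    exact (summable_norm_iff (E := V)).2 h1
  have hpow : ∀ (t : UnitAddCircle) (j : ℤ), (fourier 1 t : ℂ) ^ j = fourier j t := by
    intro t j
    rw [fourier_one, fourier_apply, AddCircle.toCircle_zsmul, Circle.coe_zpow]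
  have hnorm : ∀ (t : UnitAddCircle) (j : ℤ), ‖(fourier j t : ℂ)‖ = 1 := fun t j => by
    rw [fourier_apply]; exact Circle.norm_coe _
  have hF : ∀ t : UnitAddCircle, HasSum (fun j => fourier (-k) t • fourier j t • c j)
      (fourier (-k) t • F (fourier 1 t)) := by
    intro t
    have := h (fourier 1 t) (hnorm t 1)
    simp only [hpow] at this
    exact this.const_smul _
  have hterm : ∀ j (t : UnitAddCircle),
      fourier (-k) t • fourier j t • c j = fourier (-k + j) t • c j := by
    intro j t
    rw [smul_smul, ← fourier_add]
  have hint : ∀ m : ℤ, ∫ t : UnitAddCircle, fourier m t ∂AddCircle.haarAddCircle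
      = if m = 0 then (1 : ℂ) else 0 := by
    intro m
    have := congrFun (fourierCoeff_fourier (T := 1) m) 0
    simp only [fourierCoeff, neg_zero, fourier_zero, one_smul] at this
    rw [this]
    by_cases hm : m = 0
    · simp [hm]
    · simp [hm, Ne.symm hm]
  have hsum := hasSum_integral_of_summable_integral_norm
    (μ := (AddCircle.haarAddCircle : Measure UnitAddCircle))
    (F := fun j t => fourier (-k) t • fourier j t • c j)
    (fun j => by
      refine Continuous.integrable_of_hasCompactSupport ?_ (HasCompactSupport.of_compactSpace _)
      fun_prop)
    (by
      refine hc.congr fun j => ?_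
      simp only [norm_smul, hnorm, one_mul, integral_const, probReal_univ, one_smul])
  have e1 : ∀ j, ∫ t : UnitAddCircle, fourier (-k) t • fourier j t • c j
      ∂AddCircle.haarAddCircle = if j = k then c k else 0 := by
    intro j
    simp only [hterm]
    rw [integral_smul_const, hint]
    by_cases hj : j = k
    · simp [hj]
    · have : -k + j ≠ 0 := by omega
      simp [hj, this]
  simp only [e1] at hsum
  exact ((hasSum_ite_eq k (c k)).unique hsum).trans
    (integral_congr_ae (Eventually.of_forall fun t => (hF t).tsum_eq))

theorem laurentCoeff_unique {V : Type*} [NormedAddCommGroup V] [NormedSpace ℂ V]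
    [FiniteDimensional ℂ V] {c c' : ℤ → V} {F : ℂ → V}
    (h : ∀ z : ℂ, ‖z‖ = 1 → HasSum (fun j => z ^ j • c j) (F z))
    (h' : ∀ z : ℂ, ‖z‖ = 1 → HasSum (fun j => z ^ j • c' j) (F z)) : c = c' :=
  funext fun k => (laurentCoeff_eq_integral h k).trans (laurentCoeff_eq_integral h' k).symm

theorem norm_laurentCoeff_le {V : Type*} [NormedAddCommGroup V] [NormedSpace ℂ V]
    [FiniteDimensional ℂ V] {c : ℤ → V} {F : ℂ → V}
    (h : ∀ z : ℂ, ‖z‖ = 1 → HasSum (fun j => z ^ j • c j) (F z)) {b : ℝ}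
    (hb : ∀ z : ℂ, ‖z‖ = 1 → ‖F z‖ ≤ b) (k : ℤ) : ‖c k‖ ≤ b := by
  have hnorm : ∀ (t : UnitAddCircle) (j : ℤ), ‖(fourier j t : ℂ)‖ = 1 := fun t j => by
    rw [fourier_apply]; exact Circle.norm_coe _
  rw [laurentCoeff_eq_integral h k]
  refine (norm_integral_le_of_norm_le_const (C := b) (Eventually.of_forall fun t => ?_)).trans ?_
  · rw [norm_smul, hnorm, one_mul]
    exact hb _ (hnorm t 1)
  · simp

/-- The constant coefficient is the mean over the circle. -/
theorem laurentCoeff_zero_nonneg {c : ℤ → ℂ} {F : ℂ → ℂ}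
    (h : ∀ z : ℂ, ‖z‖ = 1 → HasSum (fun j => z ^ j • c j) (F z))
    (hF : ∀ z : ℂ, ‖z‖ = 1 → 0 ≤ F z) : 0 ≤ c 0 := by
  have hnorm : ∀ (t : UnitAddCircle) (j : ℤ), ‖(fourier j t : ℂ)‖ = 1 := fun t j => by
    rw [fourier_apply]; exact Circle.norm_coe _
  rw [laurentCoeff_eq_integral h 0]
  refine integral_nonneg fun t => ?_
  simpa using hF _ (hnorm t 1)

/-- The block Toeplitz form built from the coefficients of `F` is positive semidefinite if `F` is so
on the unit circle: with `v(z) = ∑ⱼ z ^ (-τ j) • a j`, the form is the constant coefficient of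
`v(z)ᴴ F(z) v(z)`. -/
theorem toeplitz_nonneg {n : ℕ} {C : ℤ → Matrix (Fin n) (Fin n) ℂ}
    {F : ℂ → Matrix (Fin n) (Fin n) ℂ}
    (h : ∀ z : ℂ, ‖z‖ = 1 → HasSum (fun k : ℤ => z ^ (-k) • C k) (F z))
    (hF : ∀ z : ℂ, ‖z‖ = 1 → (F z).PosSemidef) {ι : Type*} (s : Finset ι) (τ : ι → ℤ)
    (a : ι → Fin n → ℂ) :
    0 ≤ ∑ j ∈ s, ∑ l ∈ s, star (a j) ⬝ᵥ (C (τ j - τ l) *ᵥ a l) := by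
  set c : ℤ → ℂ := fun d => ∑ j ∈ s, ∑ l ∈ s, star (a j) ⬝ᵥ (C (τ j - τ l - d) *ᵥ a l) with hc
  have key : 0 ≤ c 0 := by
    refine laurentCoeff_zero_nonneg (c := c)
      (F := fun z => star (∑ j ∈ s, z ^ (-τ j) • a j) ⬝ᵥ (F z *ᵥ ∑ l ∈ s, z ^ (-τ l) • a l))
      (fun z hz => ?_) (fun z hz => (hF z hz).dotProduct_mulVec_nonneg _)
    have hz0 : z ≠ 0 := fun h0 => by simp [h0] at hz
    have hconj : ∀ j : ℤ, star (z ^ (-j)) = z ^ j := fun j => by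
      rw [star_zpow₀, Complex.star_def, ← Complex.inv_eq_conj hz, inv_zpow', neg_neg]
    have hexp : star (∑ j ∈ s, z ^ (-τ j) • a j) ⬝ᵥ (F z *ᵥ ∑ l ∈ s, z ^ (-τ l) • a l)
        = ∑ j ∈ s, ∑ l ∈ s, z ^ (τ j - τ l) * (star (a j) ⬝ᵥ (F z *ᵥ a l)) := by
      simp only [star_sum, star_smul, hconj, Matrix.mulVec_sum, Matrix.mulVec_smul,
        sum_dotProduct, dotProduct_sum, smul_dotProduct, dotProduct_smul, smul_eq_mul,
        Finset.mul_sum]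
      rw [Finset.sum_comm]
      refine Finset.sum_congr rfl fun j _ => Finset.sum_congr rfl fun l _ => ?_
      rw [mul_left_comm, ← mul_assoc, ← zpow_add₀ hz0, sub_eq_add_neg]
    rw [hexp]
    simp only [hc, Finset.smul_sum]
    refine hasSum_sum fun j _ => hasSum_sum fun l _ => ?_
    have h1 : HasSum (fun k : ℤ => z ^ (τ j - τ l) * (star (a j) ⬝ᵥ ((z ^ (-k) • C k) *ᵥ a l)))
        (z ^ (τ j - τ l) * (star (a j) ⬝ᵥ (F z *ᵥ a l))) := by
      let T : Matrix (Fin n) (Fin n) ℂ →ₗ[ℂ] ℂ :=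
        { toFun := fun M => z ^ (τ j - τ l) * (star (a j) ⬝ᵥ (M *ᵥ a l))
          map_add' := fun M N => by rw [Matrix.add_mulVec, dotProduct_add, mul_add]
          map_smul' := fun r M => by
            rw [Matrix.smul_mulVec, dotProduct_smul, smul_eq_mul, RingHom.id_apply, smul_eq_mul]
            ring }
      exact (h z hz).mapL T.toContinuousLinearMap
    rw [← (Equiv.subLeft (τ j - τ l)).hasSum_iff] at h1
    convert h1 using 2 with d
    simp only [Function.comp, Equiv.subLeft_apply, Matrix.smul_mulVec, dotProduct_smul,
      smul_eq_mul]
    rw [← mul_assoc, ← zpow_add₀ hz0]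
    congr 2
    ring
  simpa [hc] using key

/-! ### Rationality of the transfer matrix -/

theorem hasSum_of_forall_eq {ι V : Type*} [AddCommMonoid V] [TopologicalSpace V] {f g : ι → V}
    {a : V} (hg : HasSum g a) (h : ∀ i, f i = g i) : HasSum f a :=
  (funext h : f = g) ▸ hg

theorem hasSum_int_iff_nat {V : Type*} [AddCommMonoid V] [TopologicalSpace V] {f : ℤ → V} {a : V}
    (hf : ∀ j < 0, f j = 0) : HasSum (fun i : ℕ => f i) a ↔ HasSum f a := by
  refine Function.Injective.hasSum_iff (f := f) Nat.cast_injective fun j hj => hf j ?_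
  by_contra! h
  exact hj ⟨j.toNat, Int.toNat_of_nonneg h⟩

section PolynomialMatrix

open Polynomial

variable {n : ℕ}

/-- The matrix of coefficients at `z ^ d` of a polynomial matrix. The degree `d` ranges over `ℤ`, with
value `0` for negative `d`, so that polynomials and Laurent series can be compared. -/
def matCoeff (M : Matrix (Fin n) (Fin n) ℂ[X]) (d : ℤ) : Matrix (Fin n) (Fin n) ℂ :=
  if 0 ≤ d then M.map fun p => p.coeff d.toNat else 0

theorem exists_eval_eq_sum_matCoeff (M : Matrix (Fin n) (Fin n) ℂ[X]) :
    ∃ D : ℕ, (∀ d : ℤ, d ∉ Finset.Ico (0 : ℤ) D → matCoeff M d = 0) ∧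
      ∀ z : ℂ, M.map (eval z) = ∑ d ∈ Finset.Ico (0 : ℤ) D, z ^ d • matCoeff M d := by
  refine ⟨∑ a, ∑ b, (M a b).natDegree + 1, ?_, ?_⟩
  · intro d hd
    unfold matCoeff
    split_ifs with h0
    · ext a b
      simp only [Matrix.map_apply, Matrix.zero_apply]
      refine coeff_eq_zero_of_natDegree_lt ?_
      have h1 : (M a b).natDegree ≤ ∑ a, ∑ b, (M a b).natDegree :=
        (Finset.single_le_sum (f := fun b => (M a b).natDegree) (fun _ _ => Nat.zero_le _)
          (Finset.mem_univ b)).trans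
        (Finset.single_le_sum (f := fun a => ∑ b, (M a b).natDegree) (fun _ _ => Nat.zero_le _)
          (Finset.mem_univ a))
      simp only [Finset.mem_Ico, not_and, not_lt] at hd
      have := hd h0
      omega
    · rfl
  · intro z
    ext a b
    have h1 : (M a b).natDegree ≤ ∑ a, ∑ b, (M a b).natDegree :=
      (Finset.single_le_sum (f := fun b => (M a b).natDegree) (fun _ _ => Nat.zero_le _)
        (Finset.mem_univ b)).trans
      (Finset.single_le_sum (f := fun a => ∑ b, (M a b).natDegree) (fun _ _ => Nat.zero_le _)
        (Finset.mem_univ a))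
    rw [Matrix.map_apply, eval_eq_sum_range' (Nat.lt_succ_of_le h1), Matrix.sum_apply]
    refine Finset.sum_nbij (fun i : ℕ => (i : ℤ)) ?_ ?_ ?_ ?_
    · intro i hi
      simp only [Finset.mem_range] at hi
      simp only [Finset.mem_Ico]
      omega
    · exact fun _ _ _ _ h => by simpa using h
    · intro j hj
      simp only [Finset.coe_Ico, Set.mem_Ico] at hj
      exact ⟨j.toNat, by simp only [Finset.coe_range, Set.mem_Iio]; omega, by simp; omega⟩
    · intro i _
      simp [matCoeff, mul_comm]

/-- Let `Φ` have Laurent coefficients `C`, and let `X(z) = ∑_{j ≥ 0} X_j z⁻ʲ` be such that `X Φ` has no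
coefficient at `z⁻ᵐ` for `m ≥ 1`. If `q Φ = M` on the unit circle with `q` and `M` polynomial, then
`X M` is a polynomial matrix. The series for `X` need not converge on the circle: the argument
compares coefficients. -/
theorem exists_polynomial_mul {C X : ℤ → Matrix (Fin n) (Fin n) ℂ}
    {Φ : ℂ → Matrix (Fin n) (Fin n) ℂ}
    (hΦ : ∀ z : ℂ, ‖z‖ = 1 → HasSum (fun k : ℤ => z ^ (-k) • C k) (Φ z))
    (hX : ∀ j < 0, X j = 0) (hXC : ∀ m : ℤ, 1 ≤ m → HasSum (fun j => X j * C (m - j)) 0)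
    (q : ℂ[X]) (M : Matrix (Fin n) (Fin n) ℂ[X])
    (hM : ∀ z : ℂ, ‖z‖ = 1 → q.eval z • Φ z = M.map (eval z)) :
    ∃ S : Matrix (Fin n) (Fin n) ℂ[X], ∀ z : ℂ, z ≠ 0 → ∀ Y,
      HasSum (fun j : ℤ => z ^ (-j) • X j) Y → Y * M.map (eval z) = S.map (eval z) := by
  obtain ⟨D, hD0, hD⟩ := exists_eval_eq_sum_matCoeff M
  set N := q.natDegree + 1
  -- Comparing Laurent coefficients in `q Φ = M`.
  have hcoeff : (fun d : ℤ => ∑ j ∈ Finset.range N, q.coeff j • C (j - d)) = matCoeff M := by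
    refine laurentCoeff_unique (F := fun z => q.eval z • Φ z) (fun z hz => ?_) (fun z hz => ?_)
    · have hz0 : z ≠ 0 := fun h0 => by simp [h0] at hz
      simp only [eval_eq_sum_range, Finset.sum_smul, Finset.smul_sum]
      refine hasSum_sum fun j _ => ?_
      have h1 := (hΦ z hz).const_smul (q.coeff j * z ^ j)
      rw [← (Equiv.subLeft (j : ℤ)).hasSum_iff] at h1
      refine hasSum_of_forall_eq h1 fun d => ?_
      simp only [Function.comp, Equiv.subLeft_apply, smul_smul]
      congr 1
      rw [mul_comm, mul_assoc, ← zpow_natCast, ← zpow_add₀ hz0]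
      congr 2
      ring
    · rw [hM z hz, hD z]
      exact hasSum_sum_of_ne_finset_zero fun d hd => by rw [hD0 d hd, smul_zero]
  -- The coefficient of `X M` at `z ^ d`.
  set S : ℤ → Matrix (Fin n) (Fin n) ℂ :=
    fun d => ∑ e ∈ Finset.Ico (0 : ℤ) D, X (e - d) * matCoeff M e with hS
  have hSneg : ∀ d < 0, S d = 0 := by
    intro d hd
    have h1 : HasSum (fun e => X (e - d) * matCoeff M e) (S d) :=
      hasSum_sum_of_ne_finset_zero fun e he => by rw [hD0 e he, mul_zero]
    have h2 : HasSum (fun e => X (e - d) * matCoeff M e) 0 := by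
      rw [← (Equiv.addRight d).hasSum_iff]
      have h3 : HasSum (fun i => ∑ j ∈ Finset.range N, q.coeff j • (X i * C ((j - d) - i)))
          (∑ j ∈ Finset.range N, q.coeff j • (0 : Matrix (Fin n) (Fin n) ℂ)) :=
        hasSum_sum fun j _ => (hXC (j - d) (by omega)).const_smul _
      simp only [smul_zero, Finset.sum_const_zero] at h3
      convert h3 using 2 with i
      simp only [Function.comp, Equiv.coe_addRight, add_sub_cancel_right, ← hcoeff,
        Finset.mul_sum, Matrix.mul_smul]
      refine Finset.sum_congr rfl fun j _ => ?_
      rw [show (j : ℤ) - (i + d) = j - d - i by ring]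
    exact h1.unique h2
  have hSbig : ∀ d : ℤ, (D : ℤ) ≤ d → S d = 0 := by
    intro d hd
    refine Finset.sum_eq_zero fun e he => ?_
    rw [Finset.mem_Ico] at he
    rw [hX _ (by omega), zero_mul]
  refine ⟨Matrix.of fun a b => ∑ d ∈ Finset.Ico (0 : ℤ) D, monomial d.toNat (S d a b),
    fun z hz Y hY => ?_⟩
  have h1 : HasSum (fun d : ℤ => z ^ d • S d) (Y * M.map (eval z)) := by
    simp only [hD z, hS, Finset.mul_sum, Finset.smul_sum]
    refine hasSum_sum fun e _ => ?_
    have h2 := hY.mul_right (z ^ e • matCoeff M e)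
    rw [← (Equiv.subLeft e).hasSum_iff] at h2
    refine hasSum_of_forall_eq h2 fun d => ?_
    simp only [Function.comp, Equiv.subLeft_apply, Matrix.smul_mul, Matrix.mul_smul, smul_smul]
    rw [← zpow_add₀ hz]
    congr 2
    ring
  have h2 : HasSum (fun d : ℤ => z ^ d • S d) (∑ d ∈ Finset.Ico (0 : ℤ) D, z ^ d • S d) :=
    hasSum_sum_of_ne_finset_zero fun d hd => by
      by_cases h0 : d < 0
      · rw [hSneg d h0, smul_zero]
      · rw [hSbig d (by simp only [Finset.mem_Ico] at hd; omega), smul_zero]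
  rw [h1.unique h2]
  ext a b
  rw [Matrix.sum_apply, Matrix.map_apply, Matrix.of_apply, eval_finsetSum]
  refine Finset.sum_congr rfl fun d hd => ?_
  rw [Finset.mem_Ico] at hd
  rw [eval_monomial, Matrix.smul_apply, smul_eq_mul, mul_comm, ← zpow_natCast,
    Int.toNat_of_nonneg hd.1]

theorem eval_algebraMap_div (p : ℂ[X]) {q : ℂ[X]} {z : ℂ} (hq : q.eval z ≠ 0) :
    RatFunc.eval (RingHom.id ℂ) z (algebraMap ℂ[X] (RatFunc ℂ) p / algebraMap ℂ[X] (RatFunc ℂ) q) =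
      p.eval z / q.eval z := by
  have hq0 : q ≠ 0 := fun h => by simp [h] at hq
  set f := algebraMap ℂ[X] (RatFunc ℂ) p / algebraMap ℂ[X] (RatFunc ℂ) q with hf
  have h1 : f.num * q = p * f.denom := (RatFunc.num_mul_eq_mul_denom_iff hq0).2 hf
  have h2 : f.denom ∣ q := RatFunc.denom_div_dvd p q
  have h3 : f.denom.eval z ≠ 0 := fun h => hq (eval_eq_zero_of_dvd_of_eval_eq_zero h2 h)
  have h4 := congrArg (eval z) h1
  simp only [eval_mul] at h4
  simp only [RatFunc.eval, eval₂_id]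
  rw [div_eq_div_iff h3 hq, h4]

/-- A matrix of rational functions has a common denominator that vanishes only at its poles. -/
theorem exists_common_denom (Q : Matrix (Fin n) (Fin n) (RatFunc ℂ)) :
    ∃ (q : ℂ[X]) (M : Matrix (Fin n) (Fin n) ℂ[X]), ∀ z : ℂ, ¬ IsPole Q z →
      q.eval z ≠ 0 ∧ q.eval z • evalMatrix Q z = M.map (eval z) := by
  set q : ℂ[X] := ∏ a, ∏ b, (Q a b).denom with hq
  have hdvd : ∀ a b, (Q a b).denom ∣ q := fun a b =>
    (Finset.dvd_prod_of_mem (fun b => (Q a b).denom) (Finset.mem_univ b)).trans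
      (Finset.dvd_prod_of_mem (fun a => ∏ b, (Q a b).denom) (Finset.mem_univ a))
  choose t ht using hdvd
  refine ⟨q, Matrix.of fun a b => (Q a b).num * t a b, fun z hz => ?_⟩
  simp only [IsPole, not_exists] at hz
  refine ⟨?_, ?_⟩
  · simp only [hq, eval_prod]
    exact Finset.prod_ne_zero_iff.2 fun a _ => Finset.prod_ne_zero_iff.2 fun b _ => hz a b
  · ext a b
    have := hz a b
    simp only [evalMatrix, Matrix.smul_apply, Matrix.map_apply, Matrix.of_apply, RatFunc.eval,
      eval₂_id, smul_eq_mul, eval_mul]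
    rw [ht a b, eval_mul]
    field_simp

/-- If `H` solves the normal equations `C_m = ∑_{i ≥ 1} H_i C_{m-i}`, `m ≥ 1`, for the Laurent
coefficients `C` of a rational `Φ` that is invertible at one point of the unit circle, then `H` has
a rational transfer matrix. -/
theorem exists_isTransferMatrix {C : ℤ → Matrix (Fin n) (Fin n) ℂ}
    {H : ℕ → Matrix (Fin n) (Fin n) ℝ} {Φ : ℂ → Matrix (Fin n) (Fin n) ℂ}
    (hΦ : ∀ z : ℂ, ‖z‖ = 1 → HasSum (fun k : ℤ => z ^ (-k) • C k) (Φ z))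
    (hdet : (Φ 1).det ≠ 0)
    (hrat : ∃ Q : Matrix (Fin n) (Fin n) (RatFunc ℂ),
      ∀ z : ℂ, ‖z‖ = 1 → ¬ IsPole Q z ∧ evalMatrix Q z = Φ z)
    {K : ℝ} (hK : ∀ i, ‖(H (i + 1)).map Complex.ofReal‖ ≤ K)
    (hHC : ∀ m : ℤ, 1 ≤ m →
      HasSum (fun i : ℕ => (H (i + 1)).map Complex.ofReal * C (m - (i + 1))) (C m)) :
    ∃ Q, IsTransferMatrix H Q := by
  obtain ⟨Q, hQ⟩ := hrat
  obtain ⟨q, M, hqM⟩ := exists_common_denom Q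
  -- The coefficients of `1 - H(z)`.
  set X : ℤ → Matrix (Fin n) (Fin n) ℂ := fun j =>
    if j < 0 then 0 else if j = 0 then 1 else -(H j.toNat).map Complex.ofReal with hXdef
  have hX0 : X 0 = 1 := by simp [hXdef]
  have hXs : ∀ i : ℕ, X ((i + 1 : ℕ) : ℤ) = -(H (i + 1)).map Complex.ofReal := by
    intro i
    have h1 : ¬ (((i + 1 : ℕ) : ℤ) < 0) := by omega
    have h2 : ¬ (((i + 1 : ℕ) : ℤ) = 0) := by omega
    simp only [hXdef, if_neg h1, if_neg h2, Int.toNat_natCast]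
  have hXneg : ∀ j < 0, X j = 0 := fun j hj => by simp [hXdef, hj]
  have hXC : ∀ m : ℤ, 1 ≤ m → HasSum (fun j => X j * C (m - j)) 0 := by
    intro m hm
    rw [← hasSum_int_iff_nat (fun j hj => by rw [hXneg j hj, zero_mul]),
      ← hasSum_nat_add_iff' 1]
    simp only [hXs, Finset.range_one, Finset.sum_singleton, Nat.cast_zero, hX0, one_mul, sub_zero,
      zero_sub, neg_mul]
    simpa using (hHC m hm).neg
  obtain ⟨S, hS⟩ := exists_polynomial_mul hΦ hXneg hXC q M fun z hz => by
    rw [← (hQ z hz).2]; exact (hqM z (hQ z hz).1).2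
  have hev : ∀ z (A : Matrix (Fin n) (Fin n) ℂ[X]), A.map (eval z) = (evalRingHom z).mapMatrix A :=
    fun _ _ => rfl
  have hMdet : M.det ≠ 0 := by
    intro h0
    obtain ⟨hq1, hM1⟩ := hqM 1 (hQ 1 norm_one).1
    have := congrArg Matrix.det hM1
    rw [(hQ 1 norm_one).2, Matrix.det_smul, hev, ← RingHom.map_det, h0, map_zero] at this
    exact mul_ne_zero (pow_ne_zero _ hq1) hdet this
  -- From `(1 - H) M = S`, the candidate is `H = 1 - S M⁻¹ = (det M - S adj M) / det M`.
  refine ⟨Matrix.of fun a b =>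
    algebraMap ℂ[X] (RatFunc ℂ) ((M.det • (1 : Matrix (Fin n) (Fin n) ℂ[X]) - S * M.adjugate) a b) /
      algebraMap ℂ[X] (RatFunc ℂ) M.det, ?_⟩
  have hroots : ∀ᶠ z in Bornology.cobounded ℂ, M.det.eval z ≠ 0 := by
    have hfin : {z | M.det.eval z = 0}.Finite := by
      refine (M.det.roots.toFinset.finite_toSet).subset fun z hz => ?_
      simpa [hMdet, IsRoot] using hz
    exact hfin.isBounded
  have hlarge : ∀ᶠ z : ℂ in Bornology.cobounded ℂ, 1 < ‖z‖ :=
    tendsto_norm_cobounded_atTop.eventually_gt_atTop 1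
  filter_upwards [hroots, hlarge] with z hz hz1
  have hz0 : z ≠ 0 := fun h0 => by simp [h0] at hz1; linarith
  have hsum : Summable (transferTerm H z) := by
    refine Summable.of_norm_bounded (g := fun i => ‖z‖⁻¹ ^ (i + 1) * K) ?_ fun i => ?_
    · refine Summable.mul_right K ((summable_nat_add_iff 1).2 ?_)
      exact summable_geometric_of_lt_one (by positivity) (inv_lt_one_of_one_lt₀ hz1)
    · rw [transferTerm, norm_smul, norm_inv, norm_pow, inv_pow]
      exact mul_le_mul_of_nonneg_left (hK _) (by positivity)
  have hY : HasSum (fun j : ℤ => z ^ (-j) • X j) (1 - transferMatrix H z) := by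
    rw [← hasSum_int_iff_nat (fun j hj => by rw [hXneg j hj, smul_zero]),
      ← hasSum_nat_add_iff' 1]
    have h1 := hsum.hasSum.neg
    simp only [hXs, Finset.range_one, Finset.sum_singleton, Nat.cast_zero, hX0, neg_zero,
      zpow_zero, one_smul]
    convert h1 using 1
    · ext1 i
      rw [transferTerm, smul_neg, zpow_neg, zpow_natCast]
    · rw [transferMatrix]; abel
  have h1 := hS z hz0 _ hY
  have h2 : transferMatrix H z = evalMatrix (Matrix.of fun a b =>
    algebraMap ℂ[X] (RatFunc ℂ) ((M.det • (1 : Matrix (Fin n) (Fin n) ℂ[X]) - S * M.adjugate) a b) /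
      algebraMap ℂ[X] (RatFunc ℂ) M.det) z := by
    have h3 := congrArg (· * (M.map (eval z)).adjugate) h1
    simp only [mul_assoc, Matrix.mul_adjugate, Matrix.mul_smul, mul_one] at h3
    rw [hev, hev, ← RingHom.map_adjugate, ← map_mul, ← RingHom.map_det] at h3
    ext a b
    have h4 := congrFun (congrFun h3 a) b
    simp only [Matrix.smul_apply, Matrix.sub_apply, smul_eq_mul, RingHom.mapMatrix_apply,
      Matrix.map_apply, coe_evalRingHom] at h4
    simp only [evalMatrix, Matrix.map_apply, Matrix.of_apply]
    rw [eval_algebraMap_div _ hz, eq_div_iff hz, Matrix.sub_apply, eval_sub, ← h4,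
      Matrix.smul_apply, smul_eq_mul, eval_mul, Matrix.one_apply, Matrix.one_apply]
    split_ifs <;> simp <;> ring
  rw [← h2]
  exact hsum.hasSum

/-! ### Convergence up to the poles and the Cauchy estimate -/

/-- A rational transfer matrix with all poles in `|s| < ρ` is an analytic function of `u = z⁻¹` on
`|u| < ρ⁻¹`, so its expansion at infinity converges for all `|z| > ρ`. -/
theorem summable_transferTerm_of_isTransferMatrix {H : ℕ → Matrix (Fin n) (Fin n) ℝ}
    {Q : Matrix (Fin n) (Fin n) (RatFunc ℂ)} (hQ : IsTransferMatrix H Q) {ρ : ℝ} (hρ : 0 < ρ)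
    (hpoles : ∀ s, IsPole Q s → ‖s‖ < ρ) {z : ℂ} (hz : ρ < ‖z‖) :
    Summable (transferTerm H z) := by
  have hz0 : z ≠ 0 := fun h0 => by simp [h0] at hz; linarith
  refine Pi.summable.2 fun a => Pi.summable.2 fun b => ?_
  -- At `u = 0` the value has to be set by hand, since `0⁻¹ = 0`.
  set G : ℂ → ℂ := Function.update (fun u => RatFunc.eval (RingHom.id ℂ) u⁻¹ (Q a b)) 0 0 with hG
  set c : ℕ → ℂ := fun i => if i = 0 then 0 else (H i a b : ℂ) with hc
  set p : FormalMultilinearSeries ℂ ℂ ℂ := FormalMultilinearSeries.ofScalars ℂ c with hp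
  have hpc : ∀ i, p.coeff i = c i := fun i => by
    rw [hp, FormalMultilinearSeries.coeff_ofScalars]
  have hat : HasFPowerSeriesAt G p 0 := by
    rw [hasFPowerSeriesAt_iff]
    have h1 := tendsto_inv₀_nhdsNE_zero (α := ℂ) |>.eventually hQ
    rw [eventually_nhdsWithin_iff] at h1
    filter_upwards [h1] with u hu
    simp only [hpc, zero_add]
    rw [← hasSum_nat_add_iff' 1]
    simp only [Finset.range_one, Finset.sum_singleton, hc, if_true, smul_zero, sub_zero,
      Nat.succ_ne_zero, if_false]
    by_cases hu0 : u = 0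
    · simp [hu0, hG, hasSum_zero]
    · have h2 := Pi.hasSum.1 (Pi.hasSum.1 (hu hu0) a) b
      simp only [hG, Function.update_of_ne hu0]
      refine hasSum_of_forall_eq h2 fun i => ?_
      simp [transferTerm]
  have hdiff : ∀ u : ℂ, ‖u‖ < ρ⁻¹ → DifferentiableAt ℂ G u := by
    intro u hu
    by_cases hu0 : u = 0
    · rw [hu0]; exact hat.differentiableAt
    · have hden : (Q a b).denom.eval u⁻¹ ≠ 0 := fun h => by
        have h1 := hpoles _ ⟨a, b, h⟩
        rw [norm_inv] at h1
        have h2 := inv_strictAnti₀ (norm_pos_iff.2 hu0) hu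
        rw [inv_inv] at h2
        linarith
      have h1 : DifferentiableAt ℂ (fun u => RatFunc.eval (RingHom.id ℂ) u⁻¹ (Q a b)) u := by
        simp only [RatFunc.eval, eval₂_id]
        have hinv : DifferentiableAt ℂ (fun u : ℂ => u⁻¹) u := differentiableAt_inv hu0
        have hpoly : ∀ p : ℂ[X], DifferentiableAt ℂ (fun u : ℂ => p.eval u⁻¹) u := fun p =>
          DifferentiableAt.comp (g := fun x => p.eval x) u p.differentiable.differentiableAt hinv
        exact (hpoly _).div (hpoly _) hden
      refine h1.congr_of_eventuallyEq ?_
      filter_upwards [isOpen_ne.mem_nhds hu0] with v hv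
      simp only [hG, Function.update_of_ne hv]
  have hlt : ‖z‖⁻¹ < ρ⁻¹ := inv_strictAnti₀ hρ hz
  obtain ⟨r, hr1, hr2⟩ := exists_between hlt
  have hr0 : 0 < r := lt_of_le_of_lt (by positivity) hr1
  have hball := DifferentiableOn.hasFPowerSeriesOnBall (R := NNReal.mk r hr0.le) (c := 0) (f := G)
    (fun u hu => (hdiff u (by
      have : ‖u‖ ≤ r := by simpa using hu
      linarith)).differentiableWithinAt) hr0
  rw [← hat.eq_formalMultilinearSeries hball.hasFPowerSeriesAt] at hball
  have hs := (hball.hasSum (y := z⁻¹) (by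
    rw [Metric.mem_eball, edist_zero_right, ← ofReal_norm, norm_inv]
    exact ((ENNReal.ofReal_lt_ofReal_iff hr0).2 hr1).trans_eq
      (ENNReal.ofReal_eq_coe_nnreal hr0.le))).summable
  have hs' := (summable_nat_add_iff 1).2 hs
  refine hs'.congr fun i => ?_
  rw [FormalMultilinearSeries.apply_eq_pow_smul_coeff, hpc]
  simp [transferTerm, hc]

/-- The Cauchy estimate. Convergence on the circle `|z| = ρ` itself is not assumed: the bound is
obtained on the circles of radius `r > ρ`, and `r` tends to `ρ`. -/
theorem norm_coeff_le_of_transferMatrix_le {H : ℕ → Matrix (Fin n) (Fin n) ℝ} {ρ : ℝ} (hρ : 0 < ρ)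
    (hsum : ∀ z : ℂ, ρ < ‖z‖ → Summable (transferTerm H z)) {b : ℝ}
    (hb : ∀ z : ℂ, ρ ≤ ‖z‖ → ‖transferMatrix H z‖ ≤ b) (i : ℕ) :
    ‖(H (i + 1)).map Complex.ofReal‖ ≤ b * ρ ^ (i + 1) := by
  have key : ∀ r : ℝ, ρ < r → ‖(H (i + 1)).map Complex.ofReal‖ ≤ b * r ^ (i + 1) := by
    intro r hr
    have hr0 : 0 < r := hρ.trans hr
    have hnorm : ∀ z : ℂ, ‖z‖ = 1 → ‖(r : ℂ) * z⁻¹‖ = r := fun z hz => by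
      simp [hz, abs_of_pos hr0]
    have h1 := norm_laurentCoeff_le (b := b)
      (c := fun j : ℤ => if j ≤ 0 then 0 else
        ((r : ℂ) ^ j.toNat)⁻¹ • (H j.toNat).map Complex.ofReal)
      (F := fun z => transferMatrix H (r * z⁻¹))
      (fun z hz => by
        rw [← hasSum_int_iff_nat (fun j hj => by rw [if_pos hj.le, smul_zero]),
          ← hasSum_nat_add_iff' 1]
        have h2 := (hsum (r * z⁻¹) (by rw [hnorm z hz]; exact hr)).hasSum
        simp only [Finset.range_one, Finset.sum_singleton, Nat.cast_zero, le_refl, if_true,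
          smul_zero, sub_zero]
        refine hasSum_of_forall_eq h2 fun m => ?_
        have h3 : ¬ (((m + 1 : ℕ) : ℤ) ≤ 0) := by omega
        rw [if_neg h3, Int.toNat_natCast, transferTerm, smul_smul, zpow_natCast]
        congr 1
        rw [mul_pow, mul_inv, inv_pow, inv_inv, mul_comm])
      (fun z hz => hb _ (by rw [hnorm z hz]; exact hr.le)) ((i + 1 : ℕ) : ℤ)
    have h3 : ¬ (((i + 1 : ℕ) : ℤ) ≤ 0) := by omega
    rw [if_neg h3, Int.toNat_natCast, norm_smul, norm_inv, norm_pow, Complex.norm_real,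
      Real.norm_of_nonneg hr0.le, inv_mul_le_iff₀ (by positivity)] at h1
    linarith
  have hlim : Tendsto (fun r : ℝ => b * r ^ (i + 1)) (𝓝[>] ρ) (𝓝 (b * ρ ^ (i + 1))) :=
    ((continuous_const.mul (continuous_pow _)).tendsto ρ).mono_left nhdsWithin_le_nhds
  exact ge_of_tendsto hlim (by filter_upwards [self_mem_nhdsWithin] with r hr using key r hr)

theorem sum_sq_vecMul_le (A : Matrix (Fin n) (Fin n) ℝ) (x : Fin n → ℝ) :
    ∑ b, (x ᵥ* A) b ^ 2 ≤ ‖A.map Complex.ofReal‖ ^ 2 * ∑ a, x a ^ 2 := by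
  have h1 := Matrix.l2_opNorm_mulVec (A.map Complex.ofReal)ᴴ
    (WithLp.toLp 2 fun a => (x a : ℂ))
  rw [Matrix.l2_opNorm_conjTranspose] at h1
  have h2 := pow_le_pow_left₀ (norm_nonneg _) h1 2
  rw [mul_pow, EuclideanSpace.norm_sq_eq, EuclideanSpace.norm_sq_eq] at h2
  have h3 : ∀ b, ((A.map Complex.ofReal)ᴴ *ᵥ fun a => (x a : ℂ)) b = (((x ᵥ* A) b : ℝ) : ℂ) := by
    intro b
    simp [Matrix.mulVec, Matrix.vecMul, dotProduct, mul_comm]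
  simpa [h3, -Complex.ofReal_sum] using h2

end PolynomialMatrix

/-! ### Quadratic forms of a stationary sequence in a Hilbert space -/

section Hilbert

variable {E : Type*} [NormedAddCommGroup E] [InnerProductSpace ℝ E] {n : ℕ}

theorem toeplitz_nonneg_real {C : ℤ → Matrix (Fin n) (Fin n) ℝ}
    {F : ℂ → Matrix (Fin n) (Fin n) ℂ}
    (h : ∀ z : ℂ, ‖z‖ = 1 → HasSum (fun k : ℤ => z ^ (-k) • (C k).map Complex.ofReal) (F z))
    (hF : ∀ z : ℂ, ‖z‖ = 1 → (F z).PosSemidef) {ι : Type*} (s : Finset ι) (τ : ι → ℤ)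
    (a : ι → Fin n → ℝ) :
    0 ≤ ∑ j ∈ s, ∑ l ∈ s, a j ⬝ᵥ (C (τ j - τ l) *ᵥ a l) := by
  have h1 := toeplitz_nonneg h hF s τ fun j α => (a j α : ℂ)
  have h2 : ∑ j ∈ s, ∑ l ∈ s, star (fun α => (a j α : ℂ)) ⬝ᵥ
      ((C (τ j - τ l)).map Complex.ofReal *ᵥ fun α => (a l α : ℂ)) =
      ((∑ j ∈ s, ∑ l ∈ s, a j ⬝ᵥ (C (τ j - τ l) *ᵥ a l) : ℝ) : ℂ) := by
    simp [Matrix.mulVec, dotProduct]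
  rw [h2] at h1
  exact_mod_cast h1

theorem norm_sq_sum_smul {W : ℤ → Fin n → E} {R : ℤ → Matrix (Fin n) (Fin n) ℝ}
    (hR : ∀ j l a b, inner ℝ (W j a) (W l b) = R (j - l) a b) {ι : Type*} (s : Finset ι)
    (τ : ι → ℤ) (a : ι → Fin n → ℝ) :
    ‖∑ j ∈ s, ∑ α, a j α • W (τ j) α‖ ^ 2 =
      ∑ j ∈ s, ∑ l ∈ s, a j ⬝ᵥ (R (τ j - τ l) *ᵥ a l) := by
  rw [← real_inner_self_eq_norm_sq, sum_inner]
  simp only [inner_sum, sum_inner, real_inner_smul_left, real_inner_smul_right, hR,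
    Matrix.mulVec, dotProduct, Finset.mul_sum]
  refine Finset.sum_congr rfl fun j _ => Finset.sum_congr rfl fun l _ => ?_
  rw [Finset.sum_comm]
  refine Finset.sum_congr rfl fun α _ => Finset.sum_congr rfl fun β _ => ?_
  ring

/-- The block Toeplitz form of the constant spectral density `c`. -/
theorem sum_sum_diagonal {ι : Type*} (s : Finset ι) {τ : ι → ℤ} (hτ : Function.Injective τ)
    (a : ι → Fin n → ℝ) (c : ℝ) :
    ∑ j ∈ s, ∑ l ∈ s, a j ⬝ᵥ
      ((if τ j - τ l = 0 then c • (1 : Matrix (Fin n) (Fin n) ℝ) else 0) *ᵥ a l) =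
      c * ∑ j ∈ s, ∑ α, a j α ^ 2 := by
  classical
  rw [Finset.mul_sum]
  refine Finset.sum_congr rfl fun j hj => ?_
  rw [Finset.sum_eq_single_of_mem j hj]
  · simp only [sub_self, if_true, Matrix.smul_mulVec, Matrix.one_mulVec, dotProduct_smul,
      smul_eq_mul]
    simp only [dotProduct, sq]
  · intro l _ hl
    rw [if_neg, Matrix.zero_mulVec, dotProduct_zero]
    intro h0
    exact hl (hτ (sub_eq_zero.1 h0)).symm

theorem hasSum_diagonal (c : ℝ) (z : ℂ) :
    HasSum (fun k : ℤ => z ^ (-k) •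
      (if k = 0 then c • (1 : Matrix (Fin n) (Fin n) ℝ) else 0).map Complex.ofReal)
      ((c : ℂ) • (1 : Matrix (Fin n) (Fin n) ℂ)) := by
  have h1 : (c : ℂ) • (1 : Matrix (Fin n) (Fin n) ℂ) = z ^ (-(0 : ℤ)) •
      (if (0 : ℤ) = 0 then c • (1 : Matrix (Fin n) (Fin n) ℝ) else 0).map Complex.ofReal := by
    ext a b
    simp [Matrix.one_apply, apply_ite Complex.ofReal]
  rw [h1]
  refine hasSum_single 0 fun k hk => ?_
  rw [if_neg hk]
  ext a b
  simp

section Bounds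

variable {W : ℤ → Fin n → E} {R : ℤ → Matrix (Fin n) (Fin n) ℝ}
  {Φ : ℂ → Matrix (Fin n) (Fin n) ℂ}

/-- A lower bound `c` for the spectral density is a lower Riesz bound for the sequence `W`. -/
theorem le_norm_sq_sum_smul (hR : ∀ j l a b, inner ℝ (W j a) (W l b) = R (j - l) a b)
    (hΦ : ∀ z : ℂ, ‖z‖ = 1 → HasSum (fun k : ℤ => z ^ (-k) • (R k).map Complex.ofReal) (Φ z))
    {c : ℝ}
    (hc : ∀ z : ℂ, ‖z‖ = 1 → (Φ z - (c : ℂ) • (1 : Matrix (Fin n) (Fin n) ℂ)).PosSemidef)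
    {ι : Type*} (s : Finset ι) {τ : ι → ℤ} (hτ : Function.Injective τ) (a : ι → Fin n → ℝ) :
    c * ∑ j ∈ s, ∑ α, a j α ^ 2 ≤ ‖∑ j ∈ s, ∑ α, a j α • W (τ j) α‖ ^ 2 := by
  rw [norm_sq_sum_smul hR, ← sum_sum_diagonal s hτ]
  have h1 := toeplitz_nonneg_real (C := fun k => R k - if k = 0 then c • 1 else 0)
    (fun z hz => hasSum_of_forall_eq ((hΦ z hz).sub (hasSum_diagonal c z)) fun k => by
      rw [← smul_sub]; congr 1; ext a b; simp) hc s τ a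
  simp only [Matrix.sub_mulVec, dotProduct_sub, Finset.sum_sub_distrib] at h1
  linarith

/-- An upper bound `c` for the spectral density is an upper Riesz bound for the sequence `W`. -/
theorem norm_sq_sum_smul_le (hR : ∀ j l a b, inner ℝ (W j a) (W l b) = R (j - l) a b)
    (hΦ : ∀ z : ℂ, ‖z‖ = 1 → HasSum (fun k : ℤ => z ^ (-k) • (R k).map Complex.ofReal) (Φ z))
    {c : ℝ}
    (hc : ∀ z : ℂ, ‖z‖ = 1 → ((c : ℂ) • (1 : Matrix (Fin n) (Fin n) ℂ) - Φ z).PosSemidef)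
    {ι : Type*} (s : Finset ι) {τ : ι → ℤ} (hτ : Function.Injective τ) (a : ι → Fin n → ℝ) :
    ‖∑ j ∈ s, ∑ α, a j α • W (τ j) α‖ ^ 2 ≤ c * ∑ j ∈ s, ∑ α, a j α ^ 2 := by
  rw [norm_sq_sum_smul hR, ← sum_sum_diagonal s hτ]
  have h1 := toeplitz_nonneg_real (C := fun k => (if k = 0 then c • 1 else 0) - R k)
    (fun z hz => hasSum_of_forall_eq ((hasSum_diagonal c z).sub (hΦ z hz)) fun k => by
      rw [← smul_sub]; congr 1; ext a b; simp) hc s τ a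
  simp only [Matrix.sub_mulVec, dotProduct_sub, Finset.sum_sub_distrib] at h1
  linarith

end Bounds

/-! ### Optimal prediction in a Hilbert space -/

/-- Coordinate `a` of the finite-order prediction `∑_{i=1}^N Gᵢ W(k-i)`, for a sequence `W` of
`n`-tuples of vectors in a Hilbert space. -/
def finPred (W : ℤ → Fin n → E) (G : ℕ → Matrix (Fin n) (Fin n) ℝ) (k : ℤ) (N : ℕ) (a : Fin n) : E :=
  ∑ i ∈ Finset.Icc 1 N, ∑ b, G i a b • W (k - i) b

/-- `η` is the optimal prediction of `W k` from its past, with predictor coefficients `H`: it is the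
limit of the finite-order predictions with coefficients `H`, and its squared error does not exceed
that of any finite-order prediction. -/
structure IsBestPrediction (W : ℤ → Fin n → E) (H : ℕ → Matrix (Fin n) (Fin n) ℝ) (k : ℤ)
    (η : Fin n → E) : Prop where
  tendsto_pred : ∀ a, Tendsto (fun N => finPred W H k N a) atTop (𝓝 (η a))
  optimal : ∀ (G : ℕ → Matrix (Fin n) (Fin n) ℝ) (N : ℕ),
    ∑ a, ‖W k a - η a‖ ^ 2 ≤ ∑ a, ‖W k a - finPred W G k N a‖ ^ 2

theorem inner_eq_zero_of_forall_norm_le {e x : E} (h : ∀ t : ℝ, ‖e‖ ^ 2 ≤ ‖e - t • x‖ ^ 2) :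
    inner ℝ e x = 0 := by
  set s := inner ℝ e x
  set q := ‖x‖ ^ 2 with hq
  have hq0 : 0 ≤ q := by positivity
  have h1 := h (s / (q + 1))
  rw [norm_sub_sq_real, real_inner_smul_right, norm_smul, mul_pow, Real.norm_eq_abs, sq_abs,
    ← hq] at h1
  change ‖e‖ ^ 2 ≤ ‖e‖ ^ 2 - 2 * (s / (q + 1) * s) + (s / (q + 1)) ^ 2 * q at h1
  have h2 : s ^ 2 * (q + 2) / (q + 1) ^ 2 ≤ 0 := by
    have : s ^ 2 * (q + 2) / (q + 1) ^ 2 = 2 * (s / (q + 1) * s) - (s / (q + 1)) ^ 2 * q := by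
      field_simp; ring
    linarith
  by_contra hs
  have : 0 < s ^ 2 * (q + 2) / (q + 1) ^ 2 := by positivity
  linarith

section Prediction

variable {W : ℤ → Fin n → E} {R : ℤ → Matrix (Fin n) (Fin n) ℝ}
  {Φ : ℂ → Matrix (Fin n) (Fin n) ℂ} {H : ℕ → Matrix (Fin n) (Fin n) ℝ} {k : ℤ} {η : Fin n → E}

/-- The error of the optimal prediction is orthogonal to the past: otherwise adding a small multiple
of `W (k - m) c` to the prediction of coordinate `a` would reduce the error. -/
theorem IsBestPrediction.inner_past_eq_zero (h : IsBestPrediction W H k η) (a c : Fin n) {m : ℕ}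
    (hm : 1 ≤ m) : inner ℝ (W k a - η a) (W (k - m) c) = 0 := by
  refine inner_eq_zero_of_forall_norm_le fun t => ?_
  set x := W (k - m) c
  -- `G` is `H` with `t` added to the coefficient of `W (k - m) c` in coordinate `a`.
  obtain ⟨G, hG⟩ : ∃ G : ℕ → Matrix (Fin n) (Fin n) ℝ,
      ∀ i, G i = H i + if i = m then Matrix.single a c t else 0 := ⟨_, fun _ => rfl⟩
  have hpred : ∀ N, m ≤ N → ∀ a', finPred W G k N a' =
      finPred W H k N a' + if a' = a then t • x else 0 := by
    intro N hN a'
    simp only [finPred, hG, Matrix.add_apply, add_smul, Finset.sum_add_distrib]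
    congr 1
    rw [Finset.sum_eq_single_of_mem m (Finset.mem_Icc.2 ⟨hm, hN⟩)]
    · rw [Finset.sum_eq_single_of_mem c (Finset.mem_univ c)]
      · by_cases ha : a' = a
        · subst ha; simp [x]
        · simp [ha, Ne.symm ha]
      · intro b _ hb
        simp [Ne.symm hb]
    · intro i _ hi
      simp [hi]
  have hlim : Tendsto (fun N => ∑ a', ‖W k a' -
      (finPred W H k N a' + if a' = a then t • x else 0)‖ ^ 2) atTop
      (𝓝 (∑ a', ‖W k a' - (η a' + if a' = a then t • x else 0)‖ ^ 2)) :=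
    tendsto_finsetSum _ fun a' _ =>
      ((tendsto_const_nhds.sub ((h.tendsto_pred a').add_const _)).norm.pow 2)
  have h1 : ∑ a', ‖W k a' - η a'‖ ^ 2 ≤
      ∑ a', ‖W k a' - (η a' + if a' = a then t • x else 0)‖ ^ 2 := by
    refine ge_of_tendsto hlim ?_
    filter_upwards [eventually_ge_atTop m] with N hN
    simpa only [hpred N hN] using h.optimal G N
  rw [← sub_nonneg, ← Finset.sum_sub_distrib, Finset.sum_eq_single_of_mem a (Finset.mem_univ a),
    if_pos rfl, sub_nonneg, ← sub_sub] at h1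
  · exact h1
  · intro a' _ ha'
    rw [if_neg ha', add_zero, sub_self]

theorem inner_pred_eq_zero {u : E} {N : ℕ}
    (hu : ∀ (m : ℕ) c, 1 ≤ m → m ≤ N → inner ℝ u (W (k - m) c) = 0) (b : Fin n) :
    inner ℝ u (finPred W H k N b) = 0 := by
  simp only [finPred, inner_sum, real_inner_smul_right]
  refine Finset.sum_eq_zero fun i hi => Finset.sum_eq_zero fun c _ => ?_
  rw [Finset.mem_Icc] at hi
  rw [hu i c hi.1 hi.2, mul_zero]

theorem IsBestPrediction.inner_eq_zero (h : IsBestPrediction W H k η) (a b : Fin n) :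
    inner ℝ (W k a - η a) (η b) = 0 := by
  have h1 : Tendsto (fun N => inner ℝ (W k a - η a) (finPred W H k N b)) atTop
      (𝓝 (inner ℝ (W k a - η a) (η b))) := tendsto_const_nhds.inner (h.tendsto_pred b)
  refine tendsto_nhds_unique h1 (tendsto_const_nhds.congr fun N => ?_)
  exact (inner_pred_eq_zero (fun m c hm _ => h.inner_past_eq_zero a c hm) b).symm

/-- The inner products of the optimal prediction with the sequence depend only on `H` and `R`. For
`m ≥ 1` this gives the normal equations `R[m] = ∑_{i ≥ 1} H_i R[m-i]`. -/
theorem IsBestPrediction.tendsto_inner (h : IsBestPrediction W H k η)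
    (hR : ∀ j l a b, inner ℝ (W j a) (W l b) = R (j - l) a b) (m : ℤ) (a c : Fin n) :
    Tendsto (fun N : ℕ => ∑ i ∈ Finset.Icc 1 N, (H i * R (m - i)) a c) atTop
      (𝓝 (inner ℝ (η a) (W (k - m) c))) := by
  refine ((h.tendsto_pred a).inner tendsto_const_nhds).congr fun N => ?_
  simp only [finPred, sum_inner, real_inner_smul_left, hR, Matrix.mul_apply]
  refine Finset.sum_congr rfl fun i _ => Finset.sum_congr rfl fun b _ => ?_
  rw [show k - (i : ℤ) - (k - m) = m - i by ring]

/-- The prediction error covariance does not depend on time. -/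
theorem IsBestPrediction.inner_error_eq {k' : ℤ} {η' : Fin n → E} (h : IsBestPrediction W H k η)
    (h' : IsBestPrediction W H k' η')
    (hR : ∀ j l a b, inner ℝ (W j a) (W l b) = R (j - l) a b) (a b : Fin n) :
    inner ℝ (W k a - η a) (W k b - η b) = inner ℝ (W k' a - η' a) (W k' b - η' b) := by
  have h1 := tendsto_nhds_unique (h.tendsto_inner hR 0 a b) (h'.tendsto_inner hR 0 a b)
  rw [sub_zero, sub_zero] at h1
  rw [inner_sub_right, inner_sub_right, h.inner_eq_zero, h'.inner_eq_zero, inner_sub_left,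
    inner_sub_left, h1, hR, hR, sub_self, sub_self]

/-- The predictor coefficients are bounded, because the finite-order predictions converge and the
spectral density is bounded below. -/
theorem IsBestPrediction.exists_abs_le (h : IsBestPrediction W H k η)
    (hR : ∀ j l a b, inner ℝ (W j a) (W l b) = R (j - l) a b)
    (hΦ : ∀ z : ℂ, ‖z‖ = 1 → HasSum (fun k : ℤ => z ^ (-k) • (R k).map Complex.ofReal) (Φ z))
    {c : ℝ} (hc0 : 0 < c)
    (hc : ∀ z : ℂ, ‖z‖ = 1 → (Φ z - (c : ℂ) • (1 : Matrix (Fin n) (Fin n) ℂ)).PosSemidef)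
    (a b : Fin n) : ∃ K, ∀ i, 1 ≤ i → |H i a b| ≤ K := by
  obtain ⟨K, hK⟩ := (h.tendsto_pred a).norm.bddAbove_range
  have hK0 : 0 ≤ K := (norm_nonneg _).trans (hK ⟨0, rfl⟩)
  refine ⟨√(K ^ 2 / c), fun i hi => Real.abs_le_sqrt ?_⟩
  rw [le_div_iff₀ hc0, mul_comm]
  have h1 := le_norm_sq_sum_smul hR hΦ hc (Finset.Icc 1 i) (τ := fun j : ℕ => k - j)
    (fun x y hxy => by simpa using hxy) (fun j => H j a)
  refine le_trans (mul_le_mul_of_nonneg_left ?_ hc0.le)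
    (h1.trans (pow_le_pow_left₀ (norm_nonneg _) (hK ⟨i, rfl⟩) 2))
  exact (Finset.single_le_sum (f := fun b => H i a b ^ 2) (fun _ _ => sq_nonneg _)
      (Finset.mem_univ b)).trans
    (Finset.single_le_sum (f := fun i => ∑ b, H i a b ^ 2)
      (fun _ _ => Finset.sum_nonneg fun _ _ => sq_nonneg _) (Finset.mem_Icc.2 ⟨hi, le_rfl⟩))

theorem sum_Ioc_pow_le {ρ : ℝ} (h0 : 0 < ρ) (h1 : ρ < 1) (i N : ℕ) :
    ∑ j ∈ Finset.Ioc i N, (ρ ^ j) ^ 2 ≤ ρ ^ (2 * (i + 1)) / (1 - ρ) ^ 2 := by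
  have h2 : ∀ j, (ρ ^ j) ^ 2 = (ρ ^ 2) ^ j := fun j => by rw [← pow_mul, ← pow_mul, mul_comm]
  have h3 : ρ ^ 2 < 1 := by nlinarith
  simp only [h2]
  have h4 : Finset.Ioc i N = Finset.Ico (i + 1) (N + 1) := by ext; simp
  rw [h4]
  refine (geom_sum_Ico_le_of_lt_one (sq_nonneg ρ) h3).trans ?_
  rw [← pow_mul]
  gcongr
  nlinarith

/-- The error of truncating the optimal predictor to the last `i` values: by the upper Riesz bound it
is at most `c ∑_{j > i} ‖H_jᵀ x‖²`. -/
theorem IsBestPrediction.norm_sq_tail_le (h : IsBestPrediction W H k η)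
    (hR : ∀ j l a b, inner ℝ (W j a) (W l b) = R (j - l) a b)
    (hΦ : ∀ z : ℂ, ‖z‖ = 1 → HasSum (fun k : ℤ => z ^ (-k) • (R k).map Complex.ofReal) (Φ z))
    {c : ℝ} (hc0 : 0 < c)
    (hc : ∀ z : ℂ, ‖z‖ = 1 → ((c : ℂ) • (1 : Matrix (Fin n) (Fin n) ℂ) - Φ z).PosSemidef)
    {ρ b : ℝ} (hρ0 : 0 < ρ) (hρ1 : ρ < 1)
    (hH : ∀ i, ‖(H (i + 1)).map Complex.ofReal‖ ≤ b * ρ ^ (i + 1)) (i : ℕ) (x : Fin n → ℝ) :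
    ‖∑ a, x a • (η a - finPred W H k i a)‖ ^ 2 ≤
      b ^ 2 * ρ ^ (2 * (i + 1)) / (1 - ρ) ^ 2 * c * ∑ a, x a ^ 2 := by
  have hlim : Tendsto (fun N => ‖∑ a, x a • (finPred W H k N a - finPred W H k i a)‖ ^ 2) atTop
      (𝓝 (‖∑ a, x a • (η a - finPred W H k i a)‖ ^ 2)) :=
    (tendsto_finsetSum _ fun a _ => ((h.tendsto_pred a).sub_const _).const_smul _).norm.pow 2
  refine le_of_tendsto hlim ?_
  filter_upwards [eventually_ge_atTop i] with N hN
  have h1 : ∑ a, x a • (finPred W H k N a - finPred W H k i a) =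
      ∑ j ∈ Finset.Ioc i N, ∑ b, (x ᵥ* H j) b • W (k - (j : ℤ)) b := by
    have h2 : ∀ a, finPred W H k N a - finPred W H k i a =
        ∑ j ∈ Finset.Ioc i N, ∑ b, H j a b • W (k - (j : ℤ)) b := fun a => by
      have h3 : Finset.Icc 1 N = Finset.Icc 1 i ∪ Finset.Ioc i N := by ext; simp; omega
      have h4 : Disjoint (Finset.Icc 1 i) (Finset.Ioc i N) :=
        Finset.disjoint_left.2 fun y hy hy' => by simp at hy hy'; omega
      rw [finPred, finPred, h3, Finset.sum_union h4, add_sub_cancel_left]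
    simp only [h2, Finset.smul_sum, smul_smul, Matrix.vecMul, dotProduct, Finset.sum_smul]
    rw [Finset.sum_comm]
    exact Finset.sum_congr rfl fun j _ => Finset.sum_comm
  rw [h1]
  refine (norm_sq_sum_smul_le hR hΦ hc (Finset.Ioc i N) (τ := fun j : ℕ => k - j)
    (fun x y hxy => by simpa using hxy) _).trans ?_
  have hx : 0 ≤ ∑ a, x a ^ 2 := Finset.sum_nonneg fun _ _ => sq_nonneg _
  calc c * ∑ j ∈ Finset.Ioc i N, ∑ α, (x ᵥ* H j) α ^ 2
      ≤ c * ∑ j ∈ Finset.Ioc i N, (b * ρ ^ j) ^ 2 * ∑ a, x a ^ 2 := by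
        refine mul_le_mul_of_nonneg_left (Finset.sum_le_sum fun j hj => ?_) hc0.le
        refine (sum_sq_vecMul_le _ _).trans (mul_le_mul_of_nonneg_right ?_ hx)
        obtain ⟨j, rfl⟩ : ∃ j', j = j' + 1 := ⟨j - 1, by simp at hj; omega⟩
        exact pow_le_pow_left₀ (norm_nonneg _) (hH j) 2
    _ = b ^ 2 * (∑ j ∈ Finset.Ioc i N, (ρ ^ j) ^ 2) * c * ∑ a, x a ^ 2 := by
        rw [← Finset.sum_mul]
        simp only [mul_pow, ← Finset.mul_sum]
        ring
    _ ≤ b ^ 2 * (ρ ^ (2 * (i + 1)) / (1 - ρ) ^ 2) * c * ∑ a, x a ^ 2 := by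
        gcongr
        exact sum_Ioc_pow_le hρ0 hρ1 i N
    _ = _ := by rw [mul_div_assoc]

/-- The norm of a Gram matrix is at most the upper Riesz bound of the vectors. -/
theorem norm_gram_le {D : Matrix (Fin n) (Fin n) ℝ} {d : Fin n → E}
    (hD : ∀ a b, D a b = inner ℝ (d a) (d b)) {κ : ℝ} (hκ : 0 ≤ κ)
    (hd : ∀ x : Fin n → ℝ, ‖∑ a, x a • d a‖ ^ 2 ≤ κ * ∑ a, x a ^ 2) : ‖D‖ ≤ κ := by
  rw [Matrix.l2_opNorm_def]
  refine ContinuousLinearMap.opNorm_le_bound _ hκ fun x => ?_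
  have hd' : ∀ x : EuclideanSpace ℝ (Fin n), ‖∑ a, x a • d a‖ ≤ √κ * ‖x‖ := fun x => by
    refine abs_le_of_sq_le_sq' ?_ (by positivity) |>.2
    rw [mul_pow, Real.sq_sqrt hκ, EuclideanSpace.norm_sq_eq]
    simpa using hd x
  set y : EuclideanSpace ℝ (Fin n) := WithLp.toLp 2 (D *ᵥ x) with hy
  change ‖y‖ ≤ κ * ‖x‖
  have h1 : ‖y‖ ^ 2 = inner ℝ (∑ a, y a • d a) (∑ a, x a • d a) := by
    rw [EuclideanSpace.norm_sq_eq, sum_inner]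
    simp only [inner_sum, real_inner_smul_left, real_inner_smul_right, ← hD]
    refine Finset.sum_congr rfl fun a _ => ?_
    have hya : y a = ∑ c, D a c * x c := rfl
    rw [Real.norm_eq_abs, sq_abs, sq]
    nth_rewrite 2 [hya]
    rw [Finset.mul_sum]
    exact Finset.sum_congr rfl fun c _ => by ring
  have h2 : ‖y‖ * ‖y‖ ≤ κ * ‖x‖ * ‖y‖ := by
    rw [← sq, h1]
    refine (real_inner_le_norm _ _).trans ((mul_le_mul (hd' y) (hd' x) (norm_nonneg _)
      (by positivity)).trans_eq ?_)
    rw [mul_mul_mul_comm, Real.mul_self_sqrt hκ]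
    ring
  rcases (norm_nonneg y).eq_or_lt with h0 | h0
  · rw [← h0]; positivity
  · exact le_of_mul_le_mul_right h2 h0

theorem isUnit_gram (hR : ∀ j l a b, inner ℝ (W j a) (W l b) = R (j - l) a b)
    (hΦ : ∀ z : ℂ, ‖z‖ = 1 → HasSum (fun k : ℤ => z ^ (-k) • (R k).map Complex.ofReal) (Φ z))
    {c : ℝ} (hc0 : 0 < c)
    (hc : ∀ z : ℂ, ‖z‖ = 1 → (Φ z - (c : ℂ) • (1 : Matrix (Fin n) (Fin n) ℂ)).PosSemidef)
    {i : ℕ} {A : Matrix (Fin i × Fin n) (Fin i × Fin n) ℝ}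
    (hA : ∀ p q, A p q = inner ℝ (W (p.1 : ℕ) p.2) (W (q.1 : ℕ) q.2)) : IsUnit A := by
  rw [← Matrix.mulVec_injective_iff_isUnit, ← Matrix.coe_mulVecLin, ← LinearMap.ker_eq_bot,
    LinearMap.ker_eq_bot']
  intro x hx
  rw [Matrix.mulVecLin_apply] at hx
  have h1 := le_norm_sq_sum_smul hR hΦ hc Finset.univ (τ := fun j : Fin i => ((j : ℕ) : ℤ))
    (fun x y hxy => by simpa [Fin.ext_iff] using hxy) (fun j α => x (j, α))
  rw [← Fintype.sum_prod_type' (f := fun j α => x (j, α) • W ((j : ℕ) : ℤ) α),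
    ← Fintype.sum_prod_type' (f := fun j α => x (j, α) ^ 2)] at h1
  have h2 : ‖∑ p : Fin i × Fin n, x (p.1, p.2) • W ((p.1 : ℕ) : ℤ) p.2‖ ^ 2 = x ⬝ᵥ (A *ᵥ x) := by
    rw [← real_inner_self_eq_norm_sq, sum_inner]
    simp only [inner_sum, real_inner_smul_left, real_inner_smul_right, ← hA,
      Matrix.mulVec, dotProduct, Finset.mul_sum]
    refine Finset.sum_congr rfl fun p _ => Finset.sum_congr rfl fun q _ => ?_
    ring
  rw [h2, hx, dotProduct_zero] at h1
  have h3 : ∑ p : Fin i × Fin n, x (p.1, p.2) ^ 2 ≤ 0 := by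
    by_contra! h
    have := mul_pos hc0 h
    linarith
  have h4 := (Finset.sum_eq_zero_iff_of_nonneg (fun p _ => sq_nonneg _)).1
    (h3.antisymm (Finset.sum_nonneg fun p _ => sq_nonneg _))
  ext p
  simpa using h4 p (Finset.mem_univ p)

/-- The Schur complement `R₀ - B A⁻¹ Bᵀ` is the error covariance of the projection of `W i` onto the
span of `W 0, …, W (i-1)`, and `S` is that of the optimal prediction `η`. Their difference is
controlled by the error of truncating the optimal predictor to these `i` values. -/
theorem IsBestPrediction.norm_sub_schur_le {i : ℕ} (h : IsBestPrediction W H i η)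
    {A : Matrix (Fin i × Fin n) (Fin i × Fin n) ℝ} {B : Matrix (Fin n) (Fin i × Fin n) ℝ}
    {R₀ S : Matrix (Fin n) (Fin n) ℝ}
    (hA : ∀ p q, A p q = inner ℝ (W (p.1 : ℕ) p.2) (W (q.1 : ℕ) q.2))
    (hB : ∀ a p, B a p = inner ℝ (W i a) (W (p.1 : ℕ) p.2))
    (hR₀ : ∀ a b, R₀ a b = inner ℝ (W i a) (W i b))
    (hS : ∀ a b, S a b = inner ℝ (W i a - η a) (W i b - η b))
    (hAu : IsUnit A) {κ : ℝ} (hκ : 0 ≤ κ)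
    (htail : ∀ x : Fin n → ℝ, ‖∑ a, x a • (η a - finPred W H i i a)‖ ^ 2 ≤ κ * ∑ a, x a ^ 2) :
    ‖S - (R₀ - B * A⁻¹ * Bᵀ)‖ ≤ κ := by
  -- The projection of `W i` onto the span of `W 0, …, W (i-1)`.
  set π : Fin n → E := fun a => ∑ p, (B * A⁻¹) a p • W ((p.1 : ℕ) : ℤ) p.2 with hπ
  have hπ_inner : ∀ a u, inner ℝ (π a) u =
      ∑ p, (B * A⁻¹) a p * inner ℝ (W ((p.1 : ℕ) : ℤ) p.2) u := fun a u => by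
    simp only [hπ, sum_inner, real_inner_smul_left]
  have hwπ : ∀ a (p : Fin i × Fin n), inner ℝ (W i a - π a) (W ((p.1 : ℕ) : ℤ) p.2) = 0 := fun a p => by
    rw [inner_sub_left, hπ_inner, ← hB]
    simp only [← hA]
    rw [← Matrix.mul_apply, Matrix.mul_assoc,
      Matrix.nonsing_inv_mul _ ((Matrix.isUnit_iff_isUnit_det _).1 hAu), Matrix.mul_one, sub_self]
  have he : ∀ a (p : Fin i × Fin n), inner ℝ (W i a - η a) (W ((p.1 : ℕ) : ℤ) p.2) = 0 :=
    fun a p => by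
      have h1 := h.inner_past_eq_zero a p.2 (m := i - p.1) (by have := p.1.2; omega)
      rwa [show (i : ℤ) - ((i - p.1 : ℕ) : ℤ) = ((p.1 : ℕ) : ℤ) by have := p.1.2; omega] at h1
  set d : Fin n → E := fun a => η a - π a with hd
  have hdp : ∀ a (p : Fin i × Fin n), inner ℝ (d a) (W ((p.1 : ℕ) : ℤ) p.2) = 0 := fun a p => by
    have h1 : d a = (W i a - π a) - (W i a - η a) := by simp only [hd]; abel
    rw [h1, inner_sub_left, hwπ, he, sub_self]
  have hπ0 : ∀ u, (∀ p : Fin i × Fin n, inner ℝ u (W ((p.1 : ℕ) : ℤ) p.2) = 0) →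
      ∀ a, inner ℝ u (π a) = 0 := fun u hu a => by
    rw [real_inner_comm, hπ_inner]
    exact Finset.sum_eq_zero fun p _ => by rw [real_inner_comm, hu, mul_zero]
  have hpred0 : ∀ u, (∀ p : Fin i × Fin n, inner ℝ u (W ((p.1 : ℕ) : ℤ) p.2) = 0) →
      ∀ a, inner ℝ u (finPred W H i i a) = 0 := fun u hu a => by
    refine inner_pred_eq_zero (fun m c hm hmi => ?_) a
    have h1 := hu (⟨i - m, by omega⟩, c)
    rwa [show (((i - m : ℕ) : ℕ) : ℤ) = (i : ℤ) - m by omega] at h1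
  rw [norm_sub_rev]
  refine norm_gram_le (d := d) (fun a b => ?_) hκ fun x => ?_
  -- The error of `π` is the orthogonal sum of the optimal error and `d`.
  · have hed : inner ℝ (W i a - η a) (d b) = 0 := by
      rw [hd, inner_sub_right, h.inner_eq_zero, hπ0 _ (he a), sub_self]
    have hed' : inner ℝ (d a) (W i b - η b) = 0 := by
      rw [real_inner_comm, hd, inner_sub_right, h.inner_eq_zero, hπ0 _ (he b), sub_self]
    have h1 : R₀ a b - (B * A⁻¹ * Bᵀ) a b = inner ℝ (W i a - π a) (W i b - π b) := by
      rw [inner_sub_right, hπ0 _ (hwπ a), sub_zero, inner_sub_left, hπ_inner, ← hR₀,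
        Matrix.mul_apply]
      simp only [Matrix.transpose_apply, hB, real_inner_comm]
    have h2 : ∀ a, W i a - π a = (W i a - η a) + d a := fun a => by simp only [hd]; abel
    rw [Matrix.sub_apply, Matrix.sub_apply, h1, hS, h2 a, h2 b, inner_add_left, inner_add_right,
      inner_add_right, hed, hed']
    ring
  · refine le_trans ?_ (htail x)
    set u := ∑ a, x a • d a with hu
    -- `u` is orthogonal to the finite past, and `v` lies in its span.
    set v := ∑ a, x a • (π a - finPred W H i i a) with hv
    have h1 : ∑ a, x a • (η a - finPred W H i i a) = u + v := by
      rw [hu, hv, ← Finset.sum_add_distrib]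
      refine Finset.sum_congr rfl fun a _ => ?_
      rw [← smul_add]
      congr 1
      simp only [hd]; abel
    have h2 : inner ℝ u v = 0 := by
      rw [hu, hv, sum_inner]
      refine Finset.sum_eq_zero fun a _ => ?_
      rw [inner_sum]
      refine Finset.sum_eq_zero fun b _ => ?_
      rw [real_inner_smul_left, real_inner_smul_right, inner_sub_right, hπ0 _ (hdp a),
        hpred0 _ (hdp a)]
      simp
    rw [h1, norm_add_sq_real, h2]
    nlinarith [sq_nonneg ‖v‖]

end Prediction

end Hilbert

/-! ### The process as a sequence in `L²` -/

section Lp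

variable {Ω : Type*} [MeasurableSpace Ω] {P : Measure Ω} {n : ℕ}

theorem inner_toLp_toLp {f g : Ω → ℝ} (hf : MemLp f 2 P) (hg : MemLp g 2 P) :
    inner ℝ (hf.toLp f) (hg.toLp g) = ∫ ω, f ω * g ω ∂P := by
  rw [MeasureTheory.L2.inner_def]
  refine integral_congr_ae ?_
  filter_upwards [hf.coeFn_toLp, hg.coeFn_toLp] with ω h1 h2
  simp [h1, h2, mul_comm]

theorem norm_toLp_sq {f : Ω → ℝ} (hf : MemLp f 2 P) :
    ‖hf.toLp f‖ ^ 2 = ∫ ω, f ω ^ 2 ∂P := by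
  rw [← real_inner_self_eq_norm_sq, inner_toLp_toLp]
  simp only [sq]

theorem mse_eq_sum_norm_sq {u v : Ω → Fin n → ℝ} (hu : ∀ a, MemLp (fun ω => u ω a) 2 P)
    (hv : ∀ a, MemLp (fun ω => v ω a) 2 P) :
    mse P u v = ∑ a, ‖(hu a).toLp _ - (hv a).toLp _‖ ^ 2 := by
  have h : ∀ a, ‖(hu a).toLp _ - (hv a).toLp _‖ ^ 2 = ∫ ω, (u ω a - v ω a) ^ 2 ∂P := fun a => by
    rw [← MemLp.toLp_sub, norm_toLp_sq]
    rfl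
  rw [mse, integral_finsetSum]
  · simp only [h]
  · exact fun a _ => ((hu a).sub (hv a)).integrable_sq

variable {w : ℤ → Ω → Fin n → ℝ}

theorem finitePrediction_apply {Ω : Type*} {w : ℤ → Ω → Fin n → ℝ}
    (G : ℕ → Matrix (Fin n) (Fin n) ℝ) (N : ℕ) (k : ℤ) (ω : Ω) (a : Fin n) : finitePrediction w G N k ω a =
      ∑ i ∈ Finset.Icc 1 N, ∑ b, G i a b * w (k - i) ω b := by
  simp [finitePrediction, Matrix.mulVec, dotProduct]

theorem memLp_finitePrediction (hw : ∀ k a, MemLp (fun ω => w k ω a) 2 P)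
    (G : ℕ → Matrix (Fin n) (Fin n) ℝ) (N : ℕ) (k : ℤ) (a : Fin n) :
    MemLp (fun ω => finitePrediction w G N k ω a) 2 P := by
  simp only [finitePrediction_apply]
  exact memLp_finsetSum _ fun i _ => memLp_finsetSum _ fun b _ => (hw _ b).const_mul _

theorem toLp_finitePrediction (hw : ∀ k a, MemLp (fun ω => w k ω a) 2 P)
    (G : ℕ → Matrix (Fin n) (Fin n) ℝ) (N : ℕ) (k : ℤ) (a : Fin n) :
    (memLp_finitePrediction hw G N k a).toLp _ =
      finPred (fun k a => (hw k a).toLp _) G k N a := by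
  refine Lp.ext ?_
  have h1 : ∀ i ∈ Finset.Icc 1 N, (⇑(∑ b, G i a b • (hw (k - i) b).toLp _) : Ω → ℝ) =ᵐ[P]
      fun ω => ∑ b, G i a b * w (k - i) ω b := by
    intro i _
    refine (Lp.coeFn_finsetSum _ _).trans ?_
    have h2 : ∀ b, (⇑(G i a b • (hw (k - i) b).toLp _) : Ω → ℝ) =ᵐ[P]
        fun ω => G i a b * w (k - i) ω b := fun b => by
      filter_upwards [Lp.coeFn_smul (G i a b) ((hw (k - i) b).toLp _),
        (hw (k - i) b).coeFn_toLp] with ω h3 h4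
      rw [h3, Pi.smul_apply, h4, smul_eq_mul]
    filter_upwards [eventually_all.2 h2] with ω h3
    rw [Finset.sum_apply]
    exact Finset.sum_congr rfl fun b _ => h3 b
  filter_upwards [(memLp_finitePrediction hw G N k a).coeFn_toLp,
    Lp.coeFn_finsetSum (Finset.Icc 1 N) fun i : ℕ => ∑ b, G i a b • (hw (k - i) b).toLp _,
    (Finset.eventually_all _).2 h1] with ω h2 h3 h4
  rw [h2, finitePrediction_apply]
  refine Eq.trans ?_ h3.symm
  rw [Finset.sum_apply]
  exact Finset.sum_congr rfl fun i hi => (h4 i hi).symm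

theorem IsOptimalPredictor.isBestPrediction {H : ℕ → Matrix (Fin n) (Fin n) ℝ}
    {what : ℤ → Ω → Fin n → ℝ} (hH : IsOptimalPredictor P w H what)
    (hw : ∀ k a, MemLp (fun ω => w k ω a) 2 P) (k : ℤ) :
    IsBestPrediction (fun k a => (hw k a).toLp _) H k (fun a => (hH.memLp k a).toLp _) where
  tendsto_pred a := by
    have h1 := hH.series k
    simp only [mse_eq_sum_norm_sq (hH.memLp k) (memLp_finitePrediction hw H _ k),
      toLp_finitePrediction hw] at h1
    rw [tendsto_iff_norm_sub_tendsto_zero]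
    have h2 : Tendsto (fun N => ‖finPred (fun k a => (hw k a).toLp _) H k N a -
        (hH.memLp k a).toLp _‖ ^ 2) atTop (𝓝 0) := by
      refine squeeze_zero (fun _ => sq_nonneg _) (fun N => ?_) h1
      rw [norm_sub_rev]
      exact Finset.single_le_sum (f := fun a => ‖(hH.memLp k a).toLp _ -
        finPred (fun k a => (hw k a).toLp _) H k N a‖ ^ 2) (fun _ _ => sq_nonneg _)
        (Finset.mem_univ a)
    simpa using h2.sqrt
  optimal G N := by
    have h1 := hH.optimal k G N
    rw [mse_eq_sum_norm_sq (hw k) (hH.memLp k),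
      mse_eq_sum_norm_sq (hw k) (memLp_finitePrediction hw G N k)] at h1
    simpa only [toLp_finitePrediction hw] using h1

theorem exists_norm_map_le {H : ℕ → Matrix (Fin n) (Fin n) ℝ}
    (h : ∀ a b, ∃ K, ∀ i, 1 ≤ i → |H i a b| ≤ K) :
    ∃ K, ∀ i, ‖(H (i + 1)).map Complex.ofReal‖ ≤ K := by
  choose K hK using h
  refine ⟨∑ a, ∑ b, K a b * ‖(Matrix.single a b 1 : Matrix (Fin n) (Fin n) ℂ)‖, fun i => ?_⟩
  have h1 : (H (i + 1)).map Complex.ofReal =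
      ∑ a, ∑ b, (H (i + 1) a b : ℂ) • (Matrix.single a b 1 : Matrix (Fin n) (Fin n) ℂ) := by
    conv_lhs => rw [Matrix.matrix_eq_sum_single ((H (i + 1)).map Complex.ofReal)]
    simp [Matrix.smul_single]
  rw [h1]
  refine (norm_sum_le _ _).trans (Finset.sum_le_sum fun a _ =>
    (norm_sum_le _ _).trans (Finset.sum_le_sum fun b _ => ?_))
  rw [norm_smul, Complex.norm_real, Real.norm_eq_abs]
  exact mul_le_mul_of_nonneg_right (hK a b _ (by omega)) (norm_nonneg _)

theorem tendsto_sum_Icc_of_summable {V : Type*} [AddCommGroup V] [TopologicalSpace V] [T2Space V]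
    [IsTopologicalAddGroup V] {f : ℕ → V} {a : V} (hs : Summable fun i => f (i + 1))
    (h : Tendsto (fun N : ℕ => ∑ i ∈ Finset.Icc 1 N, f i) atTop (𝓝 a)) :
    HasSum (fun i => f (i + 1)) a := by
  have h1 := hs.hasSum.tendsto_sum_nat
  have h2 : ∀ N : ℕ, ∑ i ∈ Finset.Icc 1 N, f i = ∑ i ∈ Finset.range N, f (i + 1) := by
    intro N
    rw [Finset.range_eq_Ico, Finset.sum_Ico_add' f 0 N 1]
    exact Finset.sum_congr (by ext; simp) fun _ _ => rfl
  simp only [h2] at h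
  rw [← tendsto_nhds_unique h1 h]
  exact hs.hasSum

end Lp

end LinPred

open LinPred in
theorem lemma1 {Ω : Type*} [MeasurableSpace Ω] (P : Measure Ω) [IsProbabilityMeasure P]
    (n : ℕ) (w : ℤ → Ω → Fin n → ℝ) (hw : LinPred.IsStationary P w)
    (hPsd : LinPred.HasPsd P w)
    (cmin cmax : ℝ) (hcmin : 0 < cmin) (hcmax : 0 < cmax)
    (hBounds : LinPred.PsdBounds P w cmin cmax)
    (hRat : LinPred.PsdRational P w)
    (H : ℕ → Matrix (Fin n) (Fin n) ℝ) (what : ℤ → Ω → Fin n → ℝ)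
    (hH : LinPred.IsOptimalPredictor P w H what)
    (ρ : ℝ) (hρ : ρ ∈ Set.Ioo (0 : ℝ) 1)
    (hpoles : ∀ s ∈ LinPred.transferPoles H, ‖s‖ < ρ)
    (b : ℝ) (hb : ∀ z : ℂ, ρ ≤ ‖z‖ → ‖LinPred.transferMatrix H z‖ ≤ b)
    (k : ℤ) (i : ℕ) (hi : 1 ≤ i) :
    IsUnit (LinPred.pastCov P w i) ∧
    ‖LinPred.errorCov P w what k -
        (LinPred.autocov P w 0 -
          LinPred.presentPastCov P w i * (LinPred.pastCov P w i)⁻¹ *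
            (LinPred.presentPastCov P w i)ᵀ)‖ ≤
      b ^ 2 * ρ ^ (2 * (i + 1)) / (1 - ρ) ^ 2 * cmax := by
  obtain ⟨hρ0, hρ1⟩ := hρ
  set W : ℤ → Fin n → Lp ℝ 2 P := fun k a => (hw.memLp k a).toLp _ with hW
  have hbest : ∀ k, IsBestPrediction W H k (fun a => (hH.memLp k a).toLp _) :=
    hH.isBestPrediction hw.memLp
  have hinner : ∀ j l a b, inner ℝ (W j a) (W l b) = crossCov P (w j) (w l) a b :=
    fun j l a b => inner_toLp_toLp _ _
  have hR : ∀ j l a b, inner ℝ (W j a) (W l b) = autocov P w (j - l) a b := fun j l a b => by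
    rw [hinner, autocov, ← hw.cov_shift l (j - l), add_sub_cancel]
  have hΦ : ∀ z : ℂ, ‖z‖ = 1 →
      HasSum (fun k : ℤ => z ^ (-k) • (autocov P w k).map Complex.ofReal) (psd P w z) :=
    fun z hz => (hPsd z hz).hasSum
  have hlow := fun z hz => (hBounds z hz).1
  have hupp := fun z hz => (hBounds z hz).2
  have hA : ∀ p q, pastCov P w i p q = inner ℝ (W (p.1 : ℕ) p.2) (W (q.1 : ℕ) q.2) :=
    fun p q => (hinner _ _ _ _).symm
  have hAu : IsUnit (pastCov P w i) := isUnit_gram hR hΦ hcmin hlow hA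
  refine ⟨hAu, ?_⟩
  obtain ⟨K, hK⟩ := exists_norm_map_le fun a b =>
    (hbest 0).exists_abs_le hR hΦ hcmin hlow a b
  -- Without such a `Q` the set `transferPoles H` would be empty and `hpoles` void.
  obtain ⟨Q, hQ⟩ : ∃ Q, IsTransferMatrix H Q := by
    refine exists_isTransferMatrix hΦ ?_ hRat hK fun m hm => ?_
    · have h1 := hlow 1 norm_one
      have h2 : ((cmin : ℂ) • (1 : Matrix (Fin n) (Fin n) ℂ)).PosDef :=
        Matrix.PosDef.one.smul (by exact_mod_cast hcmin)
      have h3 := h2.add_posSemidef h1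
      rw [add_sub_cancel] at h3
      exact h3.det_pos.ne'
    · have hR1 : Summable fun k : ℤ => ‖(autocov P w k).map Complex.ofReal‖ := by
        have h1 := (hΦ 1 norm_one).summable
        simp only [one_zpow, one_smul] at h1
        exact (summable_norm_iff (E := Matrix (Fin n) (Fin n) ℂ)).2 h1
      have hinj : Function.Injective fun i : ℕ => m - ((i : ℤ) + 1) := fun x y h => by
        simpa using h
      have hs : Summable fun i : ℕ =>
          (H (i + 1)).map Complex.ofReal * (autocov P w (m - (i + 1))).map Complex.ofReal := by
        refine Summable.of_norm_bounded ((hR1.comp_injective hinj).mul_left K) fun i => ?_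
        exact (norm_mul_le _ _).trans (mul_le_mul_of_nonneg_right (hK i) (norm_nonneg _))
      have ht : ∀ a c, Tendsto (fun N : ℕ => ∑ i ∈ Finset.Icc 1 N,
          (H i * autocov P w (m - i)) a c) atTop (𝓝 (autocov P w m a c)) := fun a c => by
        have h1 := (hbest 0).tendsto_inner hR m a c
        have h2 := (hbest 0).inner_past_eq_zero a c (m := m.toNat) (by omega)
        rw [Int.toNat_of_nonneg (by omega), inner_sub_left, sub_eq_zero, hR] at h2
        rw [← h2] at h1
        simpa using h1
      have hentry : ∀ (i : ℕ) a c, ((H i).map Complex.ofReal *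
          (autocov P w (m - i)).map Complex.ofReal) a c =
          (((H i * autocov P w (m - i)) a c : ℝ) : ℂ) := fun i a c => by
        simp [Matrix.mul_apply]
      have h4 := tendsto_sum_Icc_of_summable
        (f := fun i : ℕ => (H i).map Complex.ofReal * (autocov P w (m - i)).map Complex.ofReal)
        (a := (autocov P w m).map Complex.ofReal) (by simpa using hs) (by
          refine tendsto_pi_nhds.2 fun a => tendsto_pi_nhds.2 fun c => ?_
          have h5 := (Complex.continuous_ofReal.tendsto _).comp (ht a c)
          refine h5.congr fun N => ?_
          rw [Matrix.sum_apply]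
          simp only [hentry, Function.comp, Complex.ofReal_sum])
      simpa using h4
  have hcoeff := norm_coeff_le_of_transferMatrix_le hρ0
    (fun z hz => summable_transferTerm_of_isTransferMatrix hQ hρ0
      (fun s hs => hpoles s ⟨Q, hQ, hs⟩) hz) hb
  have hS : ∀ k a b, errorCov P w what k a b = inner ℝ (W k a - (hH.memLp k a).toLp _)
      (W k b - (hH.memLp k b).toLp _) := fun k a b => by
    rw [hW, ← MemLp.toLp_sub, ← MemLp.toLp_sub, inner_toLp_toLp]
    rfl
  refine (hbest i).norm_sub_schur_le hA (fun a p => (hinner _ _ _ _).symm)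
    (fun a b => by rw [hR, sub_self]) (fun a b => ?_) hAu (by positivity)
    fun x => (hbest i).norm_sq_tail_le hR hΦ hcmax hupp hρ0 hρ1 hcoeff i x
  rw [hS]
  exact (hbest k).inner_error_eq (hbest i) hR a b
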